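/- \textbf{Setting.} Let $C\ge 3$ be an integer, $\mathcal X$ a measurable space, $\mathcal Y=\{1,\dots,C\}$, $\mathcal Z=\mathcal X\times\mathcal Y$, and let $P$ be a probability measure on $\mathcal Z$. Let $M\ge 1$ and let $\mathcal G$ be a class of functions $g=(g_k)_{1\le k\le C}$ from $\mathcal X$ into $[-M,M]^C$ (for instance a product $\prod_{k}\mathcal G_k$ of classes of real functions), with component classes $\mathcal G_k=\{g_k: g\in\mathcal G\}$. For $g\in\mathcal G$ put $$\rho_g(x,k)=\tfrac12\Bigl(g_k(x)-\max_{l\ne k}g_l(x)\Bigr),\qquad \rho_{\mathcal G}=\{\rho_g:g\in\mathcal G\}.$$ For $\gamma\in(0,1]$ let $\pi_\gamma(t)=0$ if $t\le 0$, $\pi_\gamma(t)=t$ if $0<t\le\gamma$, $\pi_\gamma(t)=\gamma$ if $t>\gamma$, and $\rho_{\mathcal G,\gamma}=\{\pi_\gamma\circ\rho_g: g\in\mathcal G\}$. \textbf{Dimensions.} For $\epsilon>0$, $\epsilon\text{-}\dim(\mathcal G_k)$ is the fat-shattering dimension: the maximal $n$ such that there are $n$ distinct points $t_i$ and reals $b_i$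 such that for all signs $s\in\{-1,1\}^n$ some $f\in\mathcal G_k$ satisfies $s_i(f(t_i)-b_i)\ge\epsilon$ for all $i$ ($\infty$ if there is no maximum). The margin Natarajan dimension $\epsilon\text{-N-dim}(\rho_{\mathcal G})$ is the maximal $n$ such that there are $n$ distinct points $(x_i,y_i)\in\mathcal Z$, categories $c_i\ne y_i$ and reals $b_i$ such that for all $s\in\{-1,1\}^n$ some $f\in\rho_{\mathcal G}$ satisfies, for all $i$, $f(x_i,y_i)-b_i\ge\epsilon$ if $s_i=1$, and $f(x_i,c_i)+b_i\ge\epsilon$ if $s_i=-1$ ($\infty$ if there is no maximum). \textbf{Hypothesis.} There are $d_C\in(0,2]$ and $d_\gamma,K_1,K_2>0$ such that for all $\epsilon\in(0,M]$ $$\epsilon\text{-N-dim}(\rho_{\mathcal G})\le K_1C^{d_C}\max_{1\le k\le C}\epsilon\text{-}\dim(\mathcal G_k),\qquad \max_{1\le k\le C}\epsilon\text{-}\dim(\mathcal G_k)\le K_2\,\epsilon^{-d_\gamma}.$$ \textbf{Rademacher complexity.} For $m\ge1$ let $$R_m(\rho_{\mathcal G,\gamma})=\mathbb E_{(Z_i)\sim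 P^m}\,\mathbb E_{\sigma}\,\sup_{f\in\rho_{\mathcal G,\gamma}}\frac1m\sum_{i=1}^m\sigma_if(Z_i),$$ with $\sigma$ uniform on $\{-1,1\}^m$; the expectation over the sample is understood as an outer expectation when the supremum is not measurable. Let $$F_1(C)=12^{d_\gamma}K_1K_2C^{d_C},\qquad F_2(C)=\ln\sqrt{C-1}+5\Bigl(\ln\sqrt6+\frac{1+\ln2}{2-d_\gamma}\Bigr).$$ \textbf{Theorem.} Under these assumptions, for every $\gamma\in(0,1]$: (i) If $0<d_\gamma<2$, then for all $m\ge1$ $$R_m(\rho_{\mathcal G,\gamma})\le 10\bigl(1+2^{\frac{2}{2-d_\gamma}}\bigr)\sqrt{\frac{F_1(C)}m}\;F_2(C)\,\gamma^{1-\frac{d_\gamma}2}.$$ (ii) If $d_\gamma=2$, then for all $m\ge2$ $$R_m(\rho_{\mathcal G,\gamma})\le\gamma\frac{\log_2m}{\sqrt m}+15\sqrt{\frac{F_1(C)}m}\left\lceil\log_2\frac{\sqrt m}{\log_2m}\right\rceil\ln\left((C-1)\Bigl(6\frac{\sqrt m}{\log_2m}\Bigr)^5\right).$$ (iii) If $d_\gamma>2$,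 then for all $m\ge2$ $$R_m(\rho_{\mathcal G,\gamma})\le\gamma\left(\frac{\log_2m}m\right)^{\frac1{d_\gamma}}\left[1+10\bigl(1+2^{\frac2{d_\gamma-2}}\bigr)\Bigl(\frac1\gamma\Bigr)^{\frac{d_\gamma}2}\sqrt{\frac{F_1(C)}{\log_2m}}\;\ln\left((C-1)\Bigl(6\Bigl(\frac m{\log_2m}\Bigr)^{\frac1{d_\gamma}}\Bigr)^5\right)\right].$$ -/

import Mathlib

open scoped ENNReal
open MeasureTheory

noncomputable section

namespace MarginClassifier

/-! ### Capacity measures -/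

/-- The class `F` of real functions `ε`-shatters the finite set `s`, in the sense of the
fat-shattering dimension. -/
def FatShatters {T : Type*} (F : Set (T → ℝ)) (ε : ℝ) (s : Finset T) : Prop :=
  ∃ b : T → ℝ, ∀ σ : T → ℤˣ, ∃ f ∈ F, ∀ t ∈ s,
    (σ t = 1 → ε ≤ f t - b t) ∧ (σ t = -1 → ε ≤ b t - f t)

/-- The fat-shattering dimension `ε-dim(F)`. Subsets of shattered sets are shattered, so this
supremum is the maximal cardinality of a shattered set when there is one, and `⊤` otherwise. -/
def fatDim {T : Type*} (ε : ℝ) (F : Set (T → ℝ)) : ℕ∞ :=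
  ⨆ (s : Finset T) (_ : FatShatters F ε s), (s.card : ℕ∞)

/-- The finite set `s` of labelled descriptions is `γ`-`Ψ`-shattered by `F`, where `Ψ` is a family
of maps from the set of categories into `{-1, 0, 1}`. -/
def PsiShatters {X : Type*} {C : ℕ} (Ψ : Set (Fin C → SignType)) (F : Set (X × Fin C → ℝ))
    (γ : ℝ) (s : Finset (X × Fin C)) : Prop :=
  ∃ ψ : X × Fin C → (Fin C → SignType), (∀ z ∈ s, ψ z ∈ Ψ ∧ ψ z z.2 = 1) ∧
    ∃ b : X × Fin C → ℝ, ∀ σ : X × Fin C → ℤˣ, ∃ f ∈ F, ∀ z ∈ s,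
      (σ z = 1 → ∃ k, ψ z k = 1 ∧ γ ≤ f (z.1, k) - b z) ∧
      (σ z = -1 → ∃ l, ψ z l = -1 ∧ γ ≤ f (z.1, l) + b z)

/-- The `γ`-`Ψ`-dimension of `F`. -/
def psiDim {X : Type*} {C : ℕ} (Ψ : Set (Fin C → SignType)) (γ : ℝ)
    (F : Set (X × Fin C → ℝ)) : ℕ∞ :=
  ⨆ (s : Finset (X × Fin C)) (_ : PsiShatters Ψ F γ s), (s.card : ℕ∞)

/-- The family of the maps `y ↦ 1_{y = k} - 1_{y = l}`, for `k ≠ l`. -/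
def natarajanFamily (C : ℕ) : Set (Fin C → SignType) :=
  {ψ | ∃ k l : Fin C, k ≠ l ∧ ψ = fun y => if y = k then 1 else if y = l then -1 else 0}

/-- The margin Natarajan dimension `γ-N-dim(F)`. -/
def natarajanDim {X : Type*} {C : ℕ} (γ : ℝ) (F : Set (X × Fin C → ℝ)) : ℕ∞ :=
  psiDim (natarajanFamily C) γ F

/-- The empirical Rademacher complexity of `F` at the sample `t`:
`E_σ sup_{f ∈ F} (1 / n) ∑ σ_i f (t_i)` with `σ` uniform on `{-1, 1}^n`. -/
def empiricalRademacher {T : Type*} {n : ℕ} (F : Set (T → ℝ)) (t : Fin n → T) : ℝ :=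
  (1 / 2 ^ n : ℝ) * ∑ σ : Fin n → ℤˣ,
    ⨆ f : F, (1 / n : ℝ) * ∑ i, ((σ i : ℤ) : ℝ) * (f : T → ℝ) (t i)

/-- Outer expectation: the infimum of `∫ ψ ∂μ` over the integrable `ψ ≥ φ`. It is the
expectation whenever `φ` is integrable, and it makes sense for suprema over uncountable classes,
which need not be measurable. -/
def outerExpectation {Ω : Type*} [MeasurableSpace Ω] (μ : Measure Ω) (φ : Ω → ℝ) : ℝ :=
  sInf {r | ∃ ψ : Ω → ℝ, Integrable ψ μ ∧ (∀ ω, φ ω ≤ ψ ω) ∧ r = ∫ ω, ψ ω ∂μ}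

theorem outerExpectation_eq_integral {Ω : Type*} [MeasurableSpace Ω] {μ : Measure Ω}
    {φ : Ω → ℝ} (h : Integrable φ μ) : outerExpectation μ φ = ∫ ω, φ ω ∂μ := by
  refine IsLeast.csInf_eq ⟨⟨φ, h, fun _ => le_rfl, rfl⟩, ?_⟩
  rintro r ⟨ψ, hψ, hle, rfl⟩
  exact integral_mono h hψ hle

/-- The Rademacher complexity `R_n(F)`: the expectation of the empirical Rademacher complexity
at an `n`-sample of independent random variables with law `P`. -/
def rademacher {T : Type*} [MeasurableSpace T] (P : Measure T) (n : ℕ) (F : Set (T → ℝ)) : ℝ :=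
  outerExpectation (Measure.pi fun _ : Fin n => P) fun t => empiricalRademacher F t

/-! ### Margin functions -/

/-- The margin function `ρ_g (x, k) = (g_k x - max_{l ≠ k} g_l x) / 2`. The supremum is over a
finite type, nonempty as soon as there are two categories. -/
def marginFun {X : Type*} {C : ℕ} (g : X → Fin C → ℝ) (z : X × Fin C) : ℝ :=
  (1 / 2 : ℝ) * (g z.1 z.2 - ⨆ l : {l : Fin C // l ≠ z.2}, g z.1 l)

/-- The class `ρ_G` of the margin functions of `G`. -/
def marginClass {X : Type*} {C : ℕ} (G : Set (X → Fin C → ℝ)) : Set (X × Fin C → ℝ) :=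
  marginFun '' G

/-- The piecewise-linear squashing function `π_γ`. -/
def squash (γ t : ℝ) : ℝ :=
  if t ≤ 0 then 0 else if t ≤ γ then t else γ

/-- The class `ρ_{G,γ}` of the squashed margin functions `π_γ ∘ ρ_g`. -/
def squashedMarginClass {X : Type*} {C : ℕ} (G : Set (X → Fin C → ℝ)) (γ : ℝ) :
    Set (X × Fin C → ℝ) :=
  (fun g z => squash γ (marginFun g z)) '' G

/-- The class `G_k` of the component functions of index `k` of `G`. -/
def componentClass {X : Type*} {C : ℕ} (G : Set (X → Fin C → ℝ)) (k : Fin C) : Set (X → ℝ) :=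
  (fun g x => g x k) '' G

/-- If `G` is a product of nonempty classes, its component classes are the factors. -/
theorem componentClass_product {X : Type*} {C : ℕ} (H : Fin C → Set (X → ℝ))
    (hH : ∀ k, (H k).Nonempty) (k : Fin C) :
    componentClass {g : X → Fin C → ℝ | ∀ k, (fun x => g x k) ∈ H k} k = H k := by
  ext f
  constructor
  · rintro ⟨g, hg, rfl⟩
    exact hg k
  · intro hf
    choose e he using hH
    refine ⟨fun x l => Function.update e k f l x, fun l => ?_, by simp⟩
    by_cases hl : l = k
    · subst hl; simpa using hf
    · simpa [hl] using he l

/-- `G` is a class of functions with values in `[-M, M]^C` such that, for all `ε ∈ (0, M]`,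
`ε-N-dim(ρ_G) ≤ K₁ C^{dC} max_k ε-dim(G_k)` and `max_k ε-dim(G_k) ≤ K₂ ε^{-dγ}`. -/
structure HasPolynomialDimensions {X : Type*} {C : ℕ} (G : Set (X → Fin C → ℝ))
    (M dC dγ K₁ K₂ : ℝ) : Prop where
  mem_cube : ∀ g ∈ G, ∀ x k, g x k ∈ Set.Icc (-M) M
  natarajanDim_le : ∀ ε : ℝ, 0 < ε → ε ≤ M →
    ((natarajanDim ε (marginClass G) : ℕ∞) : ℝ≥0∞) ≤
      ENNReal.ofReal (K₁ * (C : ℝ) ^ dC) * ((⨆ k, fatDim ε (componentClass G k) : ℕ∞) : ℝ≥0∞)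
  fatDim_le : ∀ ε : ℝ, 0 < ε → ε ≤ M →
    ((⨆ k, fatDim ε (componentClass G k) : ℕ∞) : ℝ≥0∞) ≤ ENNReal.ofReal (K₂ * ε ^ (-dγ))

/-- `F₁(C) = 12^{dγ} K₁ K₂ C^{dC}`. -/
def F₁ (C : ℕ) (dC dγ K₁ K₂ : ℝ) : ℝ :=
  (12 : ℝ) ^ dγ * (K₁ * K₂) * (C : ℝ) ^ dC

/-- `F₂(C) = ln √(C - 1) + 5 (ln √6 + (1 + ln 2) / (2 - dγ))`. -/
def F₂ (C : ℕ) (dγ : ℝ) : ℝ :=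
  Real.log (√((C : ℝ) - 1)) + 5 * (Real.log (√6) + (1 + Real.log 2) / (2 - dγ))

end MarginClassifier

end

/-!
The argument bounds the metric entropy of the squashed margin class on an arbitrary sample in terms
of its margin Natarajan dimension, and then chains.

*Entropy.* Let `A` be a set of `N` functions with values in `[0, γ]` that are `ε`-separated for the
empirical `L²`-distance. Two of them differ by `ε / 2` on a proportion of order `(ε / γ) ^ 2` of the
sample, so a random subsample of size of order `(γ / ε) ^ 2 ln N` keeps all the pairs separated in
this sense (`exists_tuple_many_hits`). By double counting, every subset of `A` has a point of the
subsample, a threshold among `3 γ / ε` and a category such that a fixed proportion `1 / D` of the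
subset lies above the threshold with margin `ε / 12`, and the same proportion lies below it with
that runner-up category (`exists_balanced_split`). Iterating gives a binary tree of depth
`ln N / ln D`, whose leaves are accounted for by distinct shattered partial labellings of the
subsample (`two_pow_le_card_shatteredLabellings`). Shattered labellings have at most `d` labelled
points, `d` being the dimension at scale `ε / 12`, and counting them yields
`ln N ≤ (25 / 4) d ln² ((C - 1) (6 γ / ε) ^ 5)` whatever the sample size
(`log_card_le_of_separated`). The passage from thresholds on the squashed margin to Natarajan
shattering rests on the fact that a margin `v` on the label forces a margin at least `-max v 0` on
the runner-up category (`exists_neg_max_le_marginFun`).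

*Chaining.* With Massart's maximal inequality, the nets so obtained give the bound
`h N + 2 ∑ (h (j + 1) + h j) √(W (j + 1) / m)` for every decreasing sequence of scales `h` with
entropies `W` (`signMean_chaining`). Geometric scales conclude: they tend to `0` when `dγ < 2`, and
stop at `γ log₂ m / √m` when `dγ = 2` and at `γ (log₂ m / m) ^ (1 / dγ)` when `dγ > 2`. The bound
holds for each sample, hence for the outer expectation.
-/

namespace MarginClassifier

/-! ### Shattering by partial labellings -/

section Shattering

variable {ι T Λ : Type*}

/-- A partial labelling `S` of the points is shattered by `B` when every choice, at each labelled
point `z` with label `l`, between the events `high z l` and `low z l` is realised by a single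
element of `B`. Labels bundle a threshold and a category. -/
def ShattersLabelling (high low : T → Λ → ι → Prop) (B : Finset ι) (S : T → Option Λ) : Prop :=
  ∀ τ : T → Bool, ∃ f ∈ B, ∀ z l, S z = some l →
    (τ z = true → high z l f) ∧ (τ z = false → low z l f)

theorem ShattersLabelling.mono {high low : T → Λ → ι → Prop} {B B' : Finset ι}
    (h : B ⊆ B') {S : T → Option Λ}
    (hS : ShattersLabelling high low B S) : ShattersLabelling high low B' S := by
  intro τ
  obtain ⟨f, hf, hfS⟩ := hS τ
  exact ⟨f, h hf, hfS⟩

variable [Fintype T] [Fintype Λ]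

open scoped Classical in
/-- The finite set of the partial labellings shattered by `B`. -/
noncomputable def shatteredLabellings (high low : T → Λ → ι → Prop) (B : Finset ι) :
    Finset (T → Option Λ) :=
  Finset.univ.filter (ShattersLabelling high low B)

variable {high low : T → Λ → ι → Prop}

theorem mem_shatteredLabellings {B : Finset ι} {S : T → Option Λ} :
    S ∈ shatteredLabellings high low B ↔ ShattersLabelling high low B S := by
  simp [shatteredLabellings]

theorem one_le_card_shatteredLabellings {B : Finset ι} (hB : B.Nonempty) :
    1 ≤ (shatteredLabellings high low B).card := by
  obtain ⟨f, hf⟩ := hB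
  refine Finset.card_pos.mpr ⟨fun _ => none, mem_shatteredLabellings.mpr fun τ => ⟨f, hf, ?_⟩⟩
  simp

/-- Splitting `B` at a labelled point: a labelling shattered by both parts cannot already label
that point, so it can be extended there, which makes up for its being counted once in the union. -/
theorem card_shatteredLabellings_add_le
    (hcross : ∀ z l l' f g, high z l f → low z l' f → low z l g → high z l' g → False)
    {B Bp Bm : Finset ι} (hp : Bp ⊆ B) (hm : Bm ⊆ B) {z : T} {l : Λ}
    (hhigh : ∀ f ∈ Bp, high z l f) (hlow : ∀ f ∈ Bm, low z l f) :
    (shatteredLabellings high low Bp).card + (shatteredLabellings high low Bm).card ≤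
      (shatteredLabellings high low B).card := by
  classical
  set Sp := shatteredLabellings high low Bp
  set Sm := shatteredLabellings high low Bm
  have hnone : ∀ S ∈ Sp ∩ Sm, S z = none := by
    intro S hS
    rw [Finset.mem_inter, mem_shatteredLabellings, mem_shatteredLabellings] at hS
    by_contra hne
    obtain ⟨l', hl'⟩ := Option.ne_none_iff_exists'.mp hne
    obtain ⟨f, hf, hfS⟩ := hS.1 fun _ => false
    obtain ⟨g, hg, hgS⟩ := hS.2 fun _ => true
    exact hcross z l l' f g (hhigh f hf) ((hfS z l' hl').2 rfl) (hlow g hg) ((hgS z l' hl').1 rfl)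
  let ext : (T → Option Λ) → (T → Option Λ) := fun S => Function.update S z (some l)
  have hinj : Set.InjOn ext (Sp ∩ Sm : Finset (T → Option Λ)) := by
    intro S hS S' hS' h
    funext w
    by_cases hw : w = z
    · rw [hw, hnone S hS, hnone S' hS']
    · have := congrFun h w
      simpa [ext, hw] using this
  have hdisj : Disjoint (Sp ∪ Sm) ((Sp ∩ Sm).image ext) := by
    rw [Finset.disjoint_right]
    intro U hU hU'
    obtain ⟨S, -, rfl⟩ := Finset.mem_image.mp hU
    have hz : ext S z = some l := by simp [ext]
    rcases Finset.mem_union.mp hU' with h | h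
    · obtain ⟨f, hf, hfS⟩ := mem_shatteredLabellings.mp h fun _ => false
      have h1 := (hfS z l hz).2 rfl
      have h2 := hhigh f hf
      exact hcross z l l f f h2 h1 h1 h2
    · obtain ⟨f, hf, hfS⟩ := mem_shatteredLabellings.mp h fun _ => true
      have h1 := (hfS z l hz).1 rfl
      have h2 := hlow f hf
      exact hcross z l l f f h1 h2 h2 h1
  have hsub : (Sp ∪ Sm) ∪ (Sp ∩ Sm).image ext ⊆ shatteredLabellings high low B := by
    intro U hU
    rw [mem_shatteredLabellings]
    rcases Finset.mem_union.mp hU with h | h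
    · rcases Finset.mem_union.mp h with h | h
      · exact (mem_shatteredLabellings.mp h).mono hp
      · exact (mem_shatteredLabellings.mp h).mono hm
    · obtain ⟨S, hS, rfl⟩ := Finset.mem_image.mp h
      rw [Finset.mem_inter, mem_shatteredLabellings, mem_shatteredLabellings] at hS
      intro τ
      rcases hτ : τ z with _ | _
      · obtain ⟨f, hf, hfS⟩ := hS.2 τ
        refine ⟨f, hm hf, fun w l' hw => ?_⟩
        by_cases hwz : w = z
        · subst hwz
          obtain rfl : l = l' := by simpa [ext] using hw
          exact ⟨fun h => by simp [hτ] at h, fun _ => hlow f hf⟩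
        · exact hfS w l' (by simpa [ext, hwz] using hw)
      · obtain ⟨f, hf, hfS⟩ := hS.1 τ
        refine ⟨f, hp hf, fun w l' hw => ?_⟩
        by_cases hwz : w = z
        · subst hwz
          obtain rfl : l = l' := by simpa [ext] using hw
          exact ⟨fun _ => hhigh f hf, fun h => by simp [hτ] at h⟩
        · exact hfS w l' (by simpa [ext, hwz] using hw)
  calc Sp.card + Sm.card = (Sp ∪ Sm).card + (Sp ∩ Sm).card :=
        (Finset.card_union_add_card_inter _ _).symm
    _ = (Sp ∪ Sm).card + ((Sp ∩ Sm).image ext).card := by rw [Finset.card_image_of_injOn hinj]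
    _ = ((Sp ∪ Sm) ∪ (Sp ∩ Sm).image ext).card := (Finset.card_union_of_disjoint hdisj).symm
    _ ≤ _ := Finset.card_le_card hsub

open scoped Classical in
/-- If every subset of `A` with two elements or more can be split into two parts that each keep
a proportion `1 / D` of it, then the splitting tree is binary of depth at least
`log |A| / log D`, and each of its leaves accounts for one shattered labelling. -/
theorem two_pow_le_card_shatteredLabellings
    (hcross : ∀ z l l' f g, high z l f → low z l' f → low z l g → high z l' g → False)
    {A : Finset ι} {D : ℝ} (hD : 2 ≤ D)
    (hsplit : ∀ B ⊆ A, 2 ≤ B.card → ∃ z l, (B.card : ℝ) ≤ D * (B.filter (high z l)).card ∧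
      (B.card : ℝ) ≤ D * (B.filter (low z l)).card) (k : ℕ) :
    ∀ B ⊆ A, D ^ k ≤ (B.card : ℝ) → 2 ^ k ≤ (shatteredLabellings high low B).card := by
  induction k with
  | zero =>
    intro B _ hk
    rw [pow_zero] at hk ⊢
    exact one_le_card_shatteredLabellings (Finset.card_pos.mp (by exact_mod_cast hk))
  | succ k ih =>
    intro B hB hk
    have hDk : (1 : ℝ) ≤ D ^ k := one_le_pow₀ (by linarith)
    have h2 : 2 ≤ B.card := by
      have : (2 : ℝ) ≤ B.card := by
        refine le_trans ?_ hk
        rw [pow_succ]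
        nlinarith
      exact_mod_cast this
    obtain ⟨z, l, hh, hl⟩ := hsplit B hB h2
    have key : ∀ x : ℝ, (B.card : ℝ) ≤ D * x → D ^ k ≤ x := by
      intro x hx
      have : D * D ^ k ≤ D * x := by rw [← pow_succ']; exact hk.trans hx
      exact le_of_mul_le_mul_left this (by linarith)
    have h3 := ih (B.filter (high z l)) ((Finset.filter_subset _ _).trans hB) (key _ hh)
    have h4 := ih (B.filter (low z l)) ((Finset.filter_subset _ _).trans hB) (key _ hl)
    have h5 := card_shatteredLabellings_add_le hcross (Finset.filter_subset (high z l) B)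
      (Finset.filter_subset (low z l) B) (z := z) (l := l)
      (fun f hf => (Finset.mem_filter.mp hf).2) (fun f hf => (Finset.mem_filter.mp hf).2)
    rw [pow_succ]
    omega

open scoped Classical in
/-- Weighted count of the partial labellings with at most `d` labelled points. -/
theorem card_mul_pow_le_of_support_le (𝒮 : Finset (T → Option Λ)) (d : ℕ)
    (hd : ∀ S ∈ 𝒮, (Finset.univ.filter fun z => S z ≠ none).card ≤ d) {θ : ℝ} (h0 : 0 ≤ θ)
    (h1 : θ ≤ 1) :
    (𝒮.card : ℝ) * θ ^ d ≤ (1 + Fintype.card Λ * θ) ^ Fintype.card T := by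
  let w : Option Λ → ℝ := fun o => if o ≠ none then θ else 1
  have hw : ∀ o, 0 ≤ w o := by
    intro o
    dsimp only [w]
    split_ifs <;> linarith
  have hsum : ∑ o, w o = 1 + Fintype.card Λ * θ := by
    rw [Fintype.sum_option]
    simp [w]
  have hprod : ∀ S : T → Option Λ,
      ∏ z, w (S z) = θ ^ (Finset.univ.filter fun z => S z ≠ none).card := by
    intro S
    rw [Finset.prod_ite]
    simp
  calc (𝒮.card : ℝ) * θ ^ d = ∑ S ∈ 𝒮, θ ^ d := by simp
    _ ≤ ∑ S ∈ 𝒮, ∏ z, w (S z) := Finset.sum_le_sum fun S hS => by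
        rw [hprod S]
        exact pow_le_pow_of_le_one h0 h1 (hd S hS)
    _ ≤ ∑ S : T → Option Λ, ∏ z, w (S z) :=
        Finset.sum_le_sum_of_subset_of_nonneg (Finset.subset_univ _)
          fun S _ _ => Finset.prod_nonneg fun z _ => hw _
    _ = ∏ _z : T, ∑ o, w o := by
        rw [Finset.prod_univ_sum, Fintype.piFinset_univ]
    _ = _ := by rw [Finset.prod_const, hsum, Finset.card_univ]

end Shattering

/-! ### Extraction of a small subsample and balanced splits -/

/-- A lower-tail Chernoff bound for counts: if `X` holds on a proportion `p` of the points, then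
only an exponentially small proportion of the `q`-tuples hits `X` fewer than `p q / 4` times. The
exponential moment is taken with weight `1 / 2` for each hit. -/
theorem card_tuples_few_hits_le {I : Type*} [Fintype I] (X : I → Prop) [DecidablePred X]
    {p : ℝ} (hX : p * Fintype.card I ≤ (Finset.univ.filter X).card) (q : ℕ) :
    ((Finset.univ.filter fun s : Fin q → I =>
        ((Finset.univ.filter fun j => X (s j)).card : ℝ) < p / 4 * q).card : ℝ) ≤
      (Fintype.card I : ℝ) ^ q * Real.exp (-(q * (p * (1 / 2 - Real.log 2 / 4)))) := by
  classical
  let w : I → ℝ := fun i => if X i then 1 / 2 else 1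
  have hw : ∀ i, 0 ≤ w i := by
    intro i
    dsimp only [w]
    split_ifs <;> norm_num
  have hsum : ∑ i, w i ≤ Fintype.card I * Real.exp (-(p / 2)) := by
    have h1 : ∑ i, w i = Fintype.card I - (Finset.univ.filter X).card / 2 := by
      have : ∀ i, w i = 1 - (if X i then 1 else 0) / 2 := by
        intro i
        dsimp only [w]
        split_ifs <;> norm_num
      simp only [this, Finset.sum_sub_distrib, ← Finset.sum_div, Finset.sum_boole]
      simp
    have h2 := Real.add_one_le_exp (-(p / 2))
    have h3 : (0 : ℝ) ≤ Fintype.card I := by positivity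
    rw [h1]
    nlinarith
  have hsum0 : 0 ≤ ∑ i, w i := Finset.sum_nonneg fun i _ => hw i
  have hbad : ∀ s ∈ Finset.univ.filter (fun s : Fin q → I =>
      ((Finset.univ.filter fun j => X (s j)).card : ℝ) < p / 4 * q),
      Real.exp (-(p / 4 * q * Real.log 2)) ≤ ∏ j, w (s j) := by
    intro s hs
    have hs := (Finset.mem_filter.mp hs).2
    have hp : ∏ j, w (s j) =
        Real.exp (-((Finset.univ.filter fun j => X (s j)).card * Real.log 2)) := by
      rw [Finset.prod_ite]
      simp only [Finset.prod_const, one_pow, mul_one]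
      rw [Real.exp_neg, Real.exp_nat_mul, Real.exp_log (by norm_num), one_div, inv_pow]
    rw [hp]
    apply Real.exp_le_exp.mpr
    have := Real.log_pos (by norm_num : (1 : ℝ) < 2)
    nlinarith
  have hcount := Finset.card_nsmul_le_sum _ _ _ hbad
  have htot : ∑ s : Fin q → I, ∏ j, w (s j) = (∑ i, w i) ^ q := by
    rw [← Fintype.piFinset_univ, ← Finset.prod_univ_sum, Finset.prod_const, Finset.card_univ,
      Fintype.card_fin]
  have hle := hcount.trans (Finset.sum_le_sum_of_subset_of_nonneg (Finset.subset_univ _)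
    fun s _ _ => Finset.prod_nonneg fun j _ => hw (s j))
  rw [htot, nsmul_eq_mul] at hle
  have h4 : (∑ i, w i) ^ q ≤ (Fintype.card I * Real.exp (-(p / 2))) ^ q :=
    pow_le_pow_left₀ hsum0 hsum q
  rw [mul_pow, ← Real.exp_nat_mul] at h4
  have h5 := hle.trans h4
  have h6 : Real.exp (-(q * (p * (1 / 2 - Real.log 2 / 4)))) =
      Real.exp (q * -(p / 2)) * Real.exp (p / 4 * q * Real.log 2) := by
    rw [← Real.exp_add]
    congr 1
    ring
  rw [h6, ← mul_assoc]
  have h7 := mul_le_mul_of_nonneg_right h5 (Real.exp_pos (p / 4 * q * Real.log 2)).le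
  rwa [mul_assoc, ← Real.exp_add, neg_add_cancel, Real.exp_zero, mul_one] at h7

open scoped Classical in
/-- If the exponentially small proportions of bad tuples do not exhaust the `q`-tuples, one tuple
is good for all the events at once. -/
theorem exists_tuple_many_hits {I E : Type*} [Fintype I] [Nonempty I] (ℰ : Finset E)
    (X : E → I → Prop) {p : ℝ}
    (hX : ∀ e ∈ ℰ, p * Fintype.card I ≤ (Finset.univ.filter (X e)).card) (q : ℕ)
    (hq : (ℰ.card : ℝ) * Real.exp (-(q * (p * (1 / 2 - Real.log 2 / 4)))) < 1) :
    ∃ s : Fin q → I, ∀ e ∈ ℰ, p / 4 * q ≤ (Finset.univ.filter fun j => X e (s j)).card := by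
  by_contra! hcon
  have hI : (0 : ℝ) < (Fintype.card I : ℝ) ^ q := by
    have : 0 < Fintype.card I := Fintype.card_pos
    positivity
  let bad : E → Finset (Fin q → I) := fun e => Finset.univ.filter fun s : Fin q → I =>
    ((Finset.univ.filter fun j => X e (s j)).card : ℝ) < p / 4 * q
  have hcov : (Finset.univ : Finset (Fin q → I)) ⊆ ℰ.biUnion bad := by
    intro s _
    obtain ⟨e, he, hs⟩ := hcon s
    exact Finset.mem_biUnion.mpr ⟨e, he, Finset.mem_filter.mpr ⟨Finset.mem_univ _, hs⟩⟩
  have h1 : ((Finset.univ : Finset (Fin q → I)).card : ℝ) ≤ ∑ e ∈ ℰ, ((bad e).card : ℝ) := by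
    exact_mod_cast (Finset.card_le_card hcov).trans Finset.card_biUnion_le
  have h2 : ∑ e ∈ ℰ, ((bad e).card : ℝ) ≤ ∑ e ∈ ℰ,
      (Fintype.card I : ℝ) ^ q * Real.exp (-(q * (p * (1 / 2 - Real.log 2 / 4)))) :=
    Finset.sum_le_sum fun e he => card_tuples_few_hits_le (X e) (hX e he) q
  rw [Finset.sum_const, nsmul_eq_mul] at h2
  rw [Finset.card_univ, Fintype.card_fun, Fintype.card_fin, Nat.cast_pow] at h1
  nlinarith

open scoped Classical in
/-- A balanced split by double counting over the tuple, the pairs and the labels. `R j f g` says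
that `f` exceeds `g` at the `j`-th point of the tuple. -/
theorem exists_balanced_split {ι T Λ : Type*} [Fintype Λ] {q : ℕ} (hq : 0 < q) (t : Fin q → T)
    {high low : T → Λ → ι → Prop} (R : Fin q → ι → ι → Prop)
    (hR : ∀ j f g, R j f g → ∃ l, high (t j) l f ∧ low (t j) l g) {a : ℝ} (ha : 0 < a)
    {B : Finset ι} (hB : 2 ≤ B.card)
    (hsep : ∀ f ∈ B, ∀ g ∈ B, f ≠ g →
      a * q ≤ (Finset.univ.filter fun j => R j f g ∨ R j g f).card) :
    ∃ j l, a * (B.card : ℝ) ^ 2 ≤ 4 * Fintype.card Λ *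
      ((B.filter (high (t j) l)).card * (B.filter (low (t j) l)).card) := by
  by_contra! hcon
  have hq' : (0 : ℝ) < q := by exact_mod_cast hq
  have hB' : (2 : ℝ) ≤ B.card := by exact_mod_cast hB
  let r : Fin q → ι → ι → ℝ := fun j f g => if R j f g then 1 else 0
  have hr0 : ∀ j f g, 0 ≤ r j f g := by
    intro j f g
    dsimp only [r]
    split_ifs <;> norm_num
  have h1 : ∀ x ∈ B.offDiag, a * q ≤ ∑ j, (r j x.1 x.2 + r j x.2 x.1) := by
    intro x hx
    obtain ⟨hx1, hx2, hx3⟩ := Finset.mem_offDiag.mp hx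
    refine (hsep _ hx1 _ hx2 hx3).trans ?_
    rw [Finset.card_filter]
    push_cast
    refine Finset.sum_le_sum fun j _ => ?_
    dsimp only [r]
    by_cases h : R j x.1 x.2 <;> by_cases h' : R j x.2 x.1 <;> simp [h, h']
  have h2 : (B.offDiag.card : ℝ) * (a * q) ≤
      ∑ x ∈ B.offDiag, ∑ j, (r j x.1 x.2 + r j x.2 x.1) := by
    rw [← nsmul_eq_mul]
    exact Finset.card_nsmul_le_sum _ _ _ h1
  have h3 : ∑ x ∈ B.offDiag, ∑ j, (r j x.1 x.2 + r j x.2 x.1) ≤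
      ∑ x ∈ B ×ˢ B, ∑ j, (r j x.1 x.2 + r j x.2 x.1) := by
    refine Finset.sum_le_sum_of_subset_of_nonneg ?_ fun x _ _ =>
      Finset.sum_nonneg fun j _ => add_nonneg (hr0 _ _ _) (hr0 _ _ _)
    intro x hx
    obtain ⟨hx1, hx2, -⟩ := Finset.mem_offDiag.mp hx
    exact Finset.mem_product.mpr ⟨hx1, hx2⟩
  have h4 : ∑ x ∈ B ×ˢ B, ∑ j, (r j x.1 x.2 + r j x.2 x.1) =
      2 * ∑ j, ∑ f ∈ B, ∑ g ∈ B, r j f g := by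
    rw [Finset.sum_comm, Finset.mul_sum]
    refine Finset.sum_congr rfl fun j _ => ?_
    rw [Finset.sum_product]
    simp only [Finset.sum_add_distrib]
    rw [Finset.sum_comm (f := fun f g => r j g f)]
    ring
  have h5 : ∀ j, ∑ f ∈ B, ∑ g ∈ B, r j f g ≤
      ∑ l, ((B.filter (high (t j) l)).card : ℝ) * (B.filter (low (t j) l)).card := by
    intro j
    have : ∀ f g, r j f g ≤
        ∑ l, (if high (t j) l f then (1 : ℝ) else 0) * (if low (t j) l g then 1 else 0) := by
      intro f g
      have hnn : ∀ l ∈ Finset.univ, 0 ≤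
          (if high (t j) l f then (1 : ℝ) else 0) * (if low (t j) l g then 1 else 0) := by
        intro l _
        split_ifs <;> norm_num
      by_cases h : R j f g
      · obtain ⟨l, hl1, hl2⟩ := hR j f g h
        refine le_trans ?_ (Finset.single_le_sum hnn (Finset.mem_univ l))
        simp [r, h, hl1, hl2]
      · simpa [r, h] using Finset.sum_nonneg hnn
    calc ∑ f ∈ B, ∑ g ∈ B, r j f g
        ≤ ∑ f ∈ B, ∑ g ∈ B, ∑ l, (if high (t j) l f then (1 : ℝ) else 0) *
            (if low (t j) l g then 1 else 0) :=
          Finset.sum_le_sum fun f _ => Finset.sum_le_sum fun g _ => this f g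
      _ = ∑ l, (∑ f ∈ B, if high (t j) l f then (1 : ℝ) else 0) *
            ∑ g ∈ B, if low (t j) l g then (1 : ℝ) else 0 := by
          simp only [Finset.sum_mul_sum]
          rw [Finset.sum_comm]
          rw [Finset.sum_congr rfl fun f _ => Finset.sum_comm]
          rw [Finset.sum_comm]
          rw [Finset.sum_congr rfl fun f _ => Finset.sum_comm]
      _ = _ := by simp only [Finset.sum_boole]
  have hΛ : (0 : ℝ) < Fintype.card Λ := by
    by_contra h0
    have h0 : Fintype.card Λ = 0 := by
      by_contra hne
      exact h0 (by exact_mod_cast Nat.pos_of_ne_zero hne)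
    have : IsEmpty Λ := Fintype.card_eq_zero_iff.mp h0
    have h6 : ∑ j, ∑ f ∈ B, ∑ g ∈ B, r j f g ≤ 0 := by
      refine (Finset.sum_le_sum fun j _ => h5 j).trans ?_
      simp
    have h7 : (0 : ℝ) < B.offDiag.card * (a * q) := by
      have : 0 < B.offDiag.card := by
        rw [Finset.offDiag_card]
        have : B.card * 2 ≤ B.card * B.card := Nat.mul_le_mul_left _ hB
        omega
      positivity
    linarith
  have h6 : ∑ j, ∑ f ∈ B, ∑ g ∈ B, r j f g < q * (a * (B.card : ℝ) ^ 2 / 4) := by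
    have hlt : ∀ j, ∑ f ∈ B, ∑ g ∈ B, r j f g < a * (B.card : ℝ) ^ 2 / 4 := by
      intro j
      have hne : Nonempty Λ := Fintype.card_pos_iff.mp (by exact_mod_cast hΛ)
      refine (h5 j).trans_lt ?_
      calc ∑ l, ((B.filter (high (t j) l)).card : ℝ) * (B.filter (low (t j) l)).card
          < ∑ _l : Λ, a * (B.card : ℝ) ^ 2 / (4 * Fintype.card Λ) := by
            refine Finset.sum_lt_sum_of_nonempty Finset.univ_nonempty fun l _ => ?_
            rw [lt_div_iff₀ (by positivity)]
            linarith [hcon j l]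
        _ = a * (B.card : ℝ) ^ 2 / 4 := by
            rw [Finset.sum_const, Finset.card_univ, nsmul_eq_mul]
            field_simp
    have hne : (Finset.univ : Finset (Fin q)).Nonempty := ⟨⟨0, hq⟩, Finset.mem_univ _⟩
    have := Finset.sum_lt_sum_of_nonempty hne fun j _ => hlt j
    simpa using this
  have hoff : (B.offDiag.card : ℝ) = B.card * B.card - B.card := by
    rw [Finset.offDiag_card, Nat.cast_sub (Nat.le_mul_self _)]
    push_cast
    ring
  rw [hoff] at h2
  have h8 : 0 ≤ a * q * (B.card * (B.card - 2)) :=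
    mul_nonneg (by positivity) (mul_nonneg (by linarith) (by linarith))
  nlinarith

/-! ### Metric entropy in terms of the dimension -/

/-- `ln (K (6 / e) ^ 5)` is large enough to absorb the numerical constants of the entropy bound. -/
theorem nine_le_log {K e : ℝ} (hK : 2 ≤ K) (he : 0 < e) (he1 : e ≤ 1) :
    9 ≤ Real.log (K * (6 * (1 / e)) ^ 5) := by
  have h1 : (1 : ℝ) ≤ 1 / e := by rw [le_div_iff₀ he]; linarith
  have h2 : (6 : ℝ) ^ 5 ≤ (6 * (1 / e)) ^ 5 := by
    apply pow_le_pow_left₀ (by norm_num)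
    linarith
  rw [Real.le_log_iff_exp_le (by positivity)]
  have h3 : Real.exp 9 = Real.exp 1 ^ 9 := by
    rw [← Real.exp_nat_mul]; norm_num
  have h4 : Real.exp 1 ^ 9 ≤ 2.7182818286 ^ 9 :=
    pow_le_pow_left₀ (Real.exp_pos _).le Real.exp_one_lt_d9.le 9
  rw [h3]
  refine h4.trans ?_
  have : (2.7182818286 : ℝ) ^ 9 ≤ 2 * 6 ^ 5 := by norm_num
  nlinarith

/-- The bound on `V = ln |A|` that results from comparing the lower bound `2 ^ k` on the number of
shattered labellings with the upper bound `(1 + Λ θ) ^ q θ ^ (-d)`. -/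
theorem log_card_le_of_count {V K e Λ : ℝ} {d q : ℕ} (hV : 0 < V) (hK : 2 ≤ K) (he : 0 < e)
    (he1 : e ≤ 1) (hΛ1 : 1 ≤ Λ) (hΛ : Λ ≤ 9 / 2 * K / e) (hd : 1 ≤ d)
    (hq : (q : ℝ) ≤ 9 * V / e ^ 2 + 1)
    (hcount : ∀ θ : ℝ, 0 ≤ θ → θ ≤ 1 →
      2 ^ ⌊V / Real.log (64 * Λ / (3 * e ^ 2))⌋₊ * θ ^ d ≤ (1 + Λ * θ) ^ q) :
    V ≤ 25 / 4 * d * Real.log (K * (6 * (1 / e)) ^ 5) ^ 2 := by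
  set L := Real.log (K * (6 * (1 / e)) ^ 5) with hL
  have hL9 : 9 ≤ L := nine_le_log hK he he1
  have he2 : e ^ 2 ≤ 1 := pow_le_one₀ he.le he1
  have hE : K * (6 * (1 / e)) ^ 5 = 7776 * K / e ^ 5 := by
    field_simp
    norm_num
  have hExp : Real.exp L = 7776 * K / e ^ 5 := by
    rw [hL, Real.exp_log (by positivity), hE]
  -- Both `D` and, up to the factor `L`, the parameter `Λ r` below are of order `K / e ^ 3`.
  have hcube : 162 * K / e ^ 3 ≤ Real.exp L := by
    rw [hExp]
    apply div_le_div₀ (by positivity) (by linarith) (by positivity)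
    exact pow_le_pow_of_le_one he.le he1 (by norm_num)
  set D := 64 * Λ / (3 * e ^ 2) with hDdef
  have hD1 : 21 ≤ D := by
    rw [hDdef, le_div_iff₀ (by positivity)]
    nlinarith
  have hDL : Real.log D ≤ L := by
    rw [Real.log_le_iff_le_exp (by linarith)]
    refine le_trans ?_ hcube
    have : D ≤ 64 * (9 / 2 * K / e) / (3 * e ^ 2) := by
      rw [hDdef]; gcongr
    refine this.trans ?_
    rw [show 64 * (9 / 2 * K / e) / (3 * e ^ 2) = 96 * K / e ^ 3 by field_simp; norm_num]
    gcongr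
    norm_num
  have hDpos : 0 < Real.log D := Real.log_pos (by linarith)
  set k := ⌊V / Real.log D⌋₊
  have hk : V / L - 1 ≤ k := by
    have h1 : V / L ≤ V / Real.log D := by gcongr
    have h2 := (Nat.lt_floor_add_one (V / Real.log D)).le
    linarith
  -- With weight `θ = 1 / (Λ r)`, the upper bound is `(Λ r) ^ d exp (q / r)`. The choice of `r`
  -- makes `q / r` about `V / (4 L)`, less than the `V ln 2 / L` of the lower bound.
  set r := 36 * L / e ^ 2 with hr
  have hr1 : 324 ≤ r := by
    rw [hr, le_div_iff₀ (by positivity)]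
    nlinarith
  have hΛr : 1 ≤ Λ * r := by nlinarith
  have hc := hcount (1 / (Λ * r)) (by positivity) (by
    rw [div_le_one (by positivity)]; exact hΛr)
  have hc2 : (1 + Λ * (1 / (Λ * r))) ^ q ≤ Real.exp (q / r) := by
    have : Λ * (1 / (Λ * r)) = 1 / r := by field_simp
    rw [this, div_eq_mul_one_div (q : ℝ) r, Real.exp_nat_mul]
    gcongr
    linarith [Real.add_one_le_exp (1 / r)]
  have hlog := Real.log_le_log (by positivity) (hc.trans hc2)
  rw [Real.log_exp, Real.log_mul (by positivity) (by positivity), Real.log_pow, Real.log_pow,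
    one_div, Real.log_inv] at hlog
  have hlogr : Real.log (Λ * r) ≤ 2 * L := by
    rw [Real.log_le_iff_le_exp (by positivity)]
    calc Λ * r ≤ (9 / 2 * K / e) * r := by gcongr
      _ = 162 * K / e ^ 3 * L := by rw [hr]; field_simp; norm_num
      _ ≤ Real.exp L * Real.exp L := by
          gcongr
          linarith [Real.add_one_le_exp L]
      _ = Real.exp (2 * L) := by rw [← Real.exp_add]; ring_nf
  have hqr : (q : ℝ) / r ≤ V / L / 4 + 1 / 324 := by
    calc (q : ℝ) / r ≤ (9 * V / e ^ 2 + 1) / r := by gcongr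
      _ = 9 * V / e ^ 2 / r + 1 / r := by ring
      _ ≤ V / L / 4 + 1 / 324 := by
          have h1 : 9 * V / e ^ 2 / r = V / L / 4 := by
            rw [hr]
            field_simp
            norm_num
          have h2 : 1 / r ≤ 1 / 324 := by gcongr
          linarith
  have hd' : (1 : ℝ) ≤ d := by exact_mod_cast hd
  have hdl : d * Real.log (Λ * r) ≤ d * (2 * L) := by gcongr
  have l1 := Real.log_two_gt_d9
  have l2 := Real.log_two_lt_d9
  have hu : 0 < V / L := by positivity
  have h10 : (V / L - 1) * Real.log 2 ≤ k * Real.log 2 := by gcongr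
  have hdL : 9 ≤ d * L := by nlinarith
  have h11 : V / L * (44 / 100) ≤ 2.2 * (d * L) := by nlinarith
  have h12 : V / L ≤ 25 / 4 * (d * L) := by linarith
  rw [div_le_iff₀ (by linarith)] at h12
  linarith [h12]

/-- Two functions at empirical `L²`-distance at least `ε` differ by `ε / 2` on a proportion
`3 / 4 (ε / γ)²` of the sample. -/
theorem proportion_of_sum_sq_le {n : ℕ} {γ ε : ℝ} (hγ : 0 < γ) (u v : Fin n → ℝ)
    (hu : ∀ i, u i ∈ Set.Icc 0 γ) (hv : ∀ i, v i ∈ Set.Icc 0 γ)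
    (h : n * ε ^ 2 ≤ ∑ i, (u i - v i) ^ 2) :
    3 / 4 * (ε / γ) ^ 2 * n ≤ (Finset.univ.filter fun i => ε / 2 ≤ |u i - v i|).card := by
  have h1 : ∑ i, (u i - v i) ^ 2 ≤
      ∑ i, (ε ^ 2 / 4 + γ ^ 2 * if ε / 2 ≤ |u i - v i| then 1 else 0) := by
    refine Finset.sum_le_sum fun i _ => ?_
    obtain ⟨h1, h2⟩ := hu i
    obtain ⟨h3, h4⟩ := hv i
    rw [← sq_abs (u i - v i)]
    split_ifs with hc
    · have h6 : |u i - v i| ≤ γ := abs_le.mpr ⟨by linarith, by linarith⟩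
      have h7 := pow_le_pow_left₀ (abs_nonneg _) h6 2
      nlinarith [sq_nonneg ε]
    · have h7 := pow_le_pow_left₀ (abs_nonneg (u i - v i)) (not_le.mp hc).le 2
      nlinarith
  rw [Finset.sum_add_distrib, ← Finset.mul_sum, Finset.sum_boole] at h1
  simp only [Finset.sum_const, Finset.card_univ, Fintype.card_fin, nsmul_eq_mul] at h1
  have h2 := h.trans h1
  have h3 : 3 / 4 * (ε / γ) ^ 2 * n = (3 / 4 * n * ε ^ 2) / γ ^ 2 := by
    rw [div_pow]
    ring
  rw [h3, div_le_iff₀ (by positivity)]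
  linarith

/-- Two values in `[0, γ]` that differ by `ε / 2` are separated, with margin `ε / 12` on each side,
by one of the `⌊3 γ / ε⌋` positive multiples of `ε / 3`. -/
theorem exists_threshold {γ ε u v : ℝ} (hε : 0 < ε) (hu : u ≤ γ) (hv : 0 ≤ v)
    (h : v + ε / 2 ≤ u) : ∃ i : Fin ⌊3 * (γ / ε)⌋₊,
      ε / 3 * (i + 1) + ε / 12 ≤ u ∧ v ≤ ε / 3 * (i + 1) - ε / 12 := by
  set x := (u - ε / 12) / (ε / 3) with hx
  have hxu : ε / 3 * x = u - ε / 12 := by rw [hx]; field_simp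
  have h1 : 1 ≤ x := by rw [hx, le_div_iff₀ (by positivity)]; linarith
  have hN1 : 1 ≤ ⌊x⌋₊ := Nat.le_floor (by simpa using h1)
  have hN2 : (⌊x⌋₊ : ℝ) ≤ x := Nat.floor_le (by linarith)
  have hN3 : x < ⌊x⌋₊ + 1 := Nat.lt_floor_add_one x
  have hNP : ⌊x⌋₊ ≤ ⌊3 * (γ / ε)⌋₊ := by
    apply Nat.floor_le_floor
    rw [hx, div_le_iff₀ (by positivity)]
    field_simp
    linarith
  have hc : ((⌊x⌋₊ - 1 : ℕ) : ℝ) + 1 = ⌊x⌋₊ := by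
    rw [Nat.cast_sub hN1]; simp
  refine ⟨⟨⌊x⌋₊ - 1, by omega⟩, ?_⟩
  simp only [hc]
  constructor <;> nlinarith

open scoped Classical in
/-- The entropy bound in terms of shattered labellings, for a set `A` whose subsets split in
a balanced way. Here `e` is the scale relative to the range of the functions. -/
theorem log_card_le_of_split {ι T Λ : Type*} [Fintype T] [Fintype Λ]
    {high low : T → Λ → ι → Prop}
    (hcross : ∀ z l l' f g, high z l f → low z l' f → low z l g → high z l' g → False)
    {A : Finset ι} (hA : 2 ≤ A.card) {e K d : ℝ} {q : ℕ} (he : 0 < e) (he1 : e ≤ 1) (hK : 2 ≤ K)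
    (hΛ1 : (1 : ℝ) ≤ Fintype.card Λ) (hΛ2 : (Fintype.card Λ : ℝ) ≤ 9 / 2 * K / e)
    (hT : Fintype.card T ≤ q) (hq : (q : ℝ) ≤ 9 * Real.log A.card / e ^ 2 + 1)
    (hsplit : ∀ B ⊆ A, 2 ≤ B.card → ∃ z l,
      (B.card : ℝ) ≤ 64 * Fintype.card Λ / (3 * e ^ 2) * (B.filter (high z l)).card ∧
      (B.card : ℝ) ≤ 64 * Fintype.card Λ / (3 * e ^ 2) * (B.filter (low z l)).card)
    (hdim : ∀ S ∈ shatteredLabellings high low A,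
      (((Finset.univ.filter fun z => S z ≠ none).card : ℕ) : ℝ) ≤ d) :
    Real.log A.card ≤ 25 / 4 * d * Real.log (K * (6 * (1 / e)) ^ 5) ^ 2 := by
  have hA2 : (2 : ℝ) ≤ A.card := by exact_mod_cast hA
  set V := Real.log A.card with hVdef
  have hV : 0 < V := Real.log_pos (by linarith)
  have hD2 : (2 : ℝ) ≤ 64 * Fintype.card Λ / (3 * e ^ 2) := by
    have : e ^ 2 ≤ 1 := pow_le_one₀ he.le he1
    rw [le_div_iff₀ (by positivity)]
    nlinarith
  -- A single split already shatters one point, so `d ≥ 1`.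
  have hd1 : 1 ≤ d := by
    have h2 := two_pow_le_card_shatteredLabellings hcross hD2 hsplit
    obtain ⟨z, l, hz1, hz2⟩ := hsplit A subset_rfl hA
    have hne : ∀ x : ℕ, (A.card : ℝ) ≤ 64 * Fintype.card Λ / (3 * e ^ 2) * x → 0 < x := by
      intro x hx
      by_contra h0
      obtain rfl : x = 0 := by omega
      rw [Nat.cast_zero, mul_zero] at hx
      linarith
    have h3 := card_shatteredLabellings_add_le hcross (Finset.filter_subset (high z l) A)
      (Finset.filter_subset (low z l) A) (z := z) (l := l)
      (fun f hf => (Finset.mem_filter.mp hf).2) (fun f hf => (Finset.mem_filter.mp hf).2)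
    have h4 := one_le_card_shatteredLabellings (high := high) (low := low)
      (Finset.card_pos.mp (hne _ hz1))
    have h5 := one_le_card_shatteredLabellings (high := high) (low := low)
      (Finset.card_pos.mp (hne _ hz2))
    obtain ⟨S, hS, hS'⟩ := Finset.exists_mem_ne
      (show 1 < (shatteredLabellings high low A).card by omega) fun _ => none
    obtain ⟨w, hw⟩ := Function.ne_iff.mp hS'
    refine le_trans ?_ (hdim S hS)
    have : 0 < (Finset.univ.filter fun z => S z ≠ none).card :=
      Finset.card_pos.mpr ⟨w, Finset.mem_filter.mpr ⟨Finset.mem_univ _, hw⟩⟩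
    exact_mod_cast this
  have hfloor : (⌊d⌋₊ : ℝ) ≤ d := Nat.floor_le (by linarith)
  have hmain := log_card_le_of_count (V := V) (d := ⌊d⌋₊) hV hK he he1 hΛ1 hΛ2
    (Nat.le_floor (by simpa using hd1)) hq (by
      intro θ h0 h1
      have hup := card_mul_pow_le_of_support_le (shatteredLabellings high low A) ⌊d⌋₊
        (fun S hS => Nat.le_floor (hdim S hS)) h0 h1
      have hlow := two_pow_le_card_shatteredLabellings hcross hD2 hsplit
        ⌊V / Real.log (64 * Fintype.card Λ / (3 * e ^ 2))⌋₊ A subset_rfl (by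
          have hlogD : 0 < Real.log (64 * Fintype.card Λ / (3 * e ^ 2)) :=
            Real.log_pos (by linarith)
          rw [← Real.log_le_log_iff (by positivity) (by positivity), Real.log_pow,
            ← le_div_iff₀ hlogD]
          exact Nat.floor_le (by positivity))
      have hlow' : (2 : ℝ) ^ ⌊V / Real.log (64 * Fintype.card Λ / (3 * e ^ 2))⌋₊ ≤
          (shatteredLabellings high low A).card := by exact_mod_cast hlow
      calc _ ≤ ((shatteredLabellings high low A).card : ℝ) * θ ^ ⌊d⌋₊ := by gcongr
        _ ≤ _ := hup
        _ ≤ _ := pow_le_pow_right₀ (by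
            have : 0 ≤ (Fintype.card Λ : ℝ) * θ := by positivity
            linarith) hT)
  refine hmain.trans ?_
  gcongr

open scoped Classical in
/-- Entropy bound for a class of `[0, γ]`-valued functions `φ f` together with categories `κ f`.
If at most `d` points can be simultaneously separated at margin `ε / 12`, with a prescribed
category on the low side, then an `ε`-separated set for the empirical `L²`-distance has logarithm
of its cardinality at most `(25 / 4) d ln² (K (6 γ / ε) ^ 5)`, whatever the sample size. -/
theorem log_card_le_of_separated {ι Z Γ : Type*} [Fintype Γ] [Nonempty Γ] (φ : ι → Z → ℝ)
    (κ : ι → Z → Γ)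
    {γ ε K d : ℝ} (hε : 0 < ε) (hεγ : ε ≤ γ) (hφ : ∀ f z, φ f z ∈ Set.Icc 0 γ) (hK : 2 ≤ K)
    (hΓ : (Fintype.card Γ : ℝ) ≤ 3 / 2 * K) {n : ℕ} (hn : 0 < n) (t : Fin n → Z) {A : Finset ι}
    (hA : 2 ≤ A.card)
    (hsep : ∀ f ∈ A, ∀ g ∈ A, f ≠ g → n * ε ^ 2 ≤ ∑ i, (φ f (t i) - φ g (t i)) ^ 2)
    (hd : ∀ (s : Finset Z) (b : Z → ℝ) (c : Z → Γ), (∀ τ : Z → Bool, ∃ f ∈ A, ∀ z ∈ s,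
      (τ z = true → b z + ε / 12 ≤ φ f z) ∧
      (τ z = false → φ f z ≤ b z - ε / 12 ∧ κ f z = c z)) → (s.card : ℝ) ≤ d) :
    Real.log A.card ≤ 25 / 4 * d * Real.log (K * (6 * (γ / ε)) ^ 5) ^ 2 := by
  have hγ : 0 < γ := hε.trans_le hεγ
  set e := ε / γ with he_def
  have he : 0 < e := by positivity
  have he1 : e ≤ 1 := (div_le_one hγ).mpr hεγ
  have hinv : γ / ε = 1 / e := by rw [he_def, one_div_div]
  have hA2 : (2 : ℝ) ≤ A.card := by exact_mod_cast hA
  set V := Real.log A.card with hVdef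
  have hV : 0 < V := Real.log_pos (by linarith)
  have l2 := Real.log_two_lt_d9
  -- A subsample of size `q` on which all pairs remain separated: the failure probability of one
  -- pair is `exp (-c q e ^ 2)` with `c > 2 / 9`, and there are fewer than `exp (2 V)` pairs.
  set q := ⌈9 * V / e ^ 2⌉₊ with hqdef
  have hq0 : 0 < q := Nat.ceil_pos.mpr (by positivity)
  have hq1 : 9 * V / e ^ 2 ≤ q := Nat.le_ceil _
  have hq2 : (q : ℝ) ≤ 9 * V / e ^ 2 + 1 := (Nat.ceil_lt_add_one (by positivity)).le
  have : Nonempty (Fin n) := ⟨⟨0, hn⟩⟩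
  obtain ⟨s, hs⟩ := exists_tuple_many_hits (I := Fin n) A.offDiag
    (fun x i => ε / 2 ≤ |φ x.1 (t i) - φ x.2 (t i)|) (p := 3 / 4 * e ^ 2) (fun x hx => by
      obtain ⟨hx1, hx2, hx3⟩ := Finset.mem_offDiag.mp hx
      rw [Fintype.card_fin]
      exact proportion_of_sum_sq_le hγ _ _ (fun i => hφ _ _) (fun i => hφ _ _)
        (hsep _ hx1 _ hx2 hx3)) q (by
      have h1 : (A.offDiag.card : ℝ) < Real.exp (2 * V) := by
        have : A.offDiag.card < A.card * A.card := by
          rw [Finset.offDiag_card]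
          have : 0 < A.card * A.card := by positivity
          omega
        rw [two_mul, Real.exp_add, hVdef, Real.exp_log (by linarith)]
        exact_mod_cast this
      have h2 : 2 * V ≤ q * (3 / 4 * e ^ 2 * (1 / 2 - Real.log 2 / 4)) := by
        rw [div_le_iff₀ (by positivity)] at hq1
        nlinarith
      calc _ < Real.exp (2 * V) *
            Real.exp (-(q * (3 / 4 * e ^ 2 * (1 / 2 - Real.log 2 / 4)))) := by gcongr
        _ ≤ 1 := by
          rw [← Real.exp_add, Real.exp_le_one_iff]
          linarith)
  obtain ⟨U, hU, hUq⟩ : ∃ U : Finset Z, (∀ j, t (s j) ∈ U) ∧ U.card ≤ q :=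
    ⟨Finset.univ.image fun j => t (s j), fun j => Finset.mem_image_of_mem _ (Finset.mem_univ j),
      Finset.card_image_le.trans (by simp)⟩
  let t' : Fin q → U := fun j => ⟨t (s j), hU j⟩
  let Λ := Fin ⌊3 * (γ / ε)⌋₊ × Γ
  let thr : Λ → ℝ := fun l => ε / 3 * (l.1 + 1)
  -- Label `(i, c)` stands for the threshold `(i + 1) ε / 3` and the category `c`.
  obtain ⟨high, hhigh⟩ : ∃ high : U → Λ → ι → Prop,
      ∀ z l f, high z l f ↔ thr l + ε / 12 ≤ φ f z := ⟨_, fun _ _ _ => Iff.rfl⟩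
  obtain ⟨low, hlow⟩ : ∃ low : U → Λ → ι → Prop,
      ∀ z l f, low z l f ↔ φ f z ≤ thr l - ε / 12 ∧ κ f z = l.2 :=
    ⟨_, fun _ _ _ => Iff.rfl⟩
  have hcross : ∀ z l l' f g, high z l f → low z l' f → low z l g → high z l' g → False := by
    intro z l l' f g h1 h2 h3 h4
    rw [hhigh] at h1 h4
    rw [hlow] at h2 h3
    linarith
  have hP1 : 1 ≤ ⌊3 * (γ / ε)⌋₊ := by
    apply Nat.le_floor
    have : 1 ≤ γ / ε := (one_le_div hε).mpr hεγ
    push_cast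
    linarith
  have hΛcard : (Fintype.card Λ : ℝ) = ⌊3 * (γ / ε)⌋₊ * Fintype.card Γ := by
    simp [Λ]
  have hΛ1 : (1 : ℝ) ≤ Fintype.card Λ := by
    rw [hΛcard]
    exact_mod_cast Nat.mul_pos hP1 Fintype.card_pos
  have hΛ2 : (Fintype.card Λ : ℝ) ≤ 9 / 2 * K / e := by
    have : (⌊3 * (γ / ε)⌋₊ : ℝ) ≤ 3 * (γ / ε) := Nat.floor_le (by positivity)
    rw [hΛcard]
    calc (⌊3 * (γ / ε)⌋₊ : ℝ) * Fintype.card Γ ≤ 3 * (γ / ε) * (3 / 2 * K) := by gcongr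
      _ = 9 / 2 * K / e := by rw [hinv]; ring
  have hsplit : ∀ B ⊆ A, 2 ≤ B.card → ∃ z l,
      (B.card : ℝ) ≤ 64 * Fintype.card Λ / (3 * e ^ 2) * (B.filter (high z l)).card ∧
      (B.card : ℝ) ≤ 64 * Fintype.card Λ / (3 * e ^ 2) * (B.filter (low z l)).card := by
    intro B hB hB2
    obtain ⟨j, l, hjl⟩ := exists_balanced_split hq0 t' (high := high) (low := low)
      (fun j f g => φ g (t (s j)) + ε / 2 ≤ φ f (t (s j))) (fun j f g hfg => by
        obtain ⟨i, hi1, hi2⟩ := exists_threshold hε (hφ f _).2 (hφ g _).1 hfg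
        exact ⟨(i, κ g (t (s j))), (hhigh _ _ _).mpr hi1, (hlow _ _ _).mpr ⟨hi2, rfl⟩⟩)
      (a := 3 / 4 * e ^ 2 / 4) (by positivity) hB2
      (fun f hf g hg hfg => by
        refine (hs (f, g) (Finset.mem_offDiag.mpr ⟨hB hf, hB hg, hfg⟩)).trans ?_
        norm_cast
        refine Finset.card_le_card fun j hj => ?_
        simp only [Finset.mem_filter, Finset.mem_univ, true_and] at hj ⊢
        rcases le_abs.mp hj with h | h
        · left; linarith
        · right; linarith)
    have hBpos : (0 : ℝ) < B.card := by
      have : 0 < B.card := by omega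
      exact_mod_cast this
    have hle : ∀ p : ι → Prop, ((B.filter p).card : ℝ) ≤ B.card := fun p => by
      exact_mod_cast Finset.card_filter_le B p
    have key : ∀ x y : ℝ, 0 ≤ x → y ≤ B.card →
        3 / 4 * e ^ 2 / 4 * (B.card : ℝ) ^ 2 ≤ 4 * Fintype.card Λ * (x * y) →
        (B.card : ℝ) ≤ 64 * Fintype.card Λ / (3 * e ^ 2) * x := by
      intro x y hx hy hxy
      rw [div_mul_eq_mul_div, le_div_iff₀ (by positivity)]
      have h1 : 4 * Fintype.card Λ * (x * y) ≤ 4 * Fintype.card Λ * (x * B.card) := by gcongr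
      refine le_of_mul_le_mul_right (a := (B.card : ℝ)) ?_ hBpos
      nlinarith
    refine ⟨t' j, l, key _ _ (by positivity) (hle _) hjl,
      key _ _ (by positivity) (hle (high (t' j) l)) ?_⟩
    rw [mul_comm ((B.filter (low (t' j) l)).card : ℝ)]
    exact hjl
  have hdim : ∀ S ∈ shatteredLabellings high low A,
      (((Finset.univ.filter fun z => S z ≠ none).card : ℕ) : ℝ) ≤ d := by
    intro S hS
    rw [mem_shatteredLabellings] at hS
    have h1 := hd ((Finset.univ.filter fun z => S z ≠ none).map (Function.Embedding.subtype _))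
      (fun z => if h : z ∈ U then
        (S ⟨z, h⟩).elim 0 thr else 0)
      (fun z => if h : z ∈ U then
        (S ⟨z, h⟩).elim (Classical.arbitrary Γ) Prod.snd else Classical.arbitrary Γ) (by
      intro τ
      obtain ⟨f, hf, hfS⟩ := hS fun z => τ z
      refine ⟨f, hf, fun z hz => ?_⟩
      obtain ⟨w, hw, rfl⟩ := Finset.mem_map.mp hz
      have hw' := (Finset.mem_filter.mp hw).2
      obtain ⟨l, hl⟩ := Option.ne_none_iff_exists'.mp hw'
      have hmem : (w : Z) ∈ U := w.2
      have := hfS w l hl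
      rw [hhigh, hlow] at this
      simp only [Function.Embedding.coe_subtype, hmem, dif_pos, Subtype.coe_eta, hl,
        Option.elim_some]
      exact this)
    rwa [Finset.card_map] at h1
  rw [hinv]
  exact log_card_le_of_split hcross hA he he1 hK hΛ1 hΛ2 (by rwa [Fintype.card_coe]) hq2 hsplit hdim

/-! ### Chaining -/

section Chaining

variable {n : ℕ}

/-- The expectation of `Φ σ` for `σ` uniform on `{-1, 1}^n`. -/
noncomputable def signMean (Φ : (Fin n → ℤˣ) → ℝ) : ℝ := (1 / 2 ^ n : ℝ) * ∑ σ, Φ σ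

/-- The signed sum `∑ σ_i u_i`. -/
noncomputable def signSum (σ : Fin n → ℤˣ) (u : Fin n → ℝ) : ℝ := ∑ i, ((σ i : ℤ) : ℝ) * u i

theorem signMean_add (Φ Ψ : (Fin n → ℤˣ) → ℝ) :
    signMean (fun σ => Φ σ + Ψ σ) = signMean Φ + signMean Ψ := by
  simp only [signMean, Finset.sum_add_distrib, mul_add]

theorem signMean_mono {Φ Ψ : (Fin n → ℤˣ) → ℝ} (h : ∀ σ, Φ σ ≤ Ψ σ) :
    signMean Φ ≤ signMean Ψ :=
  mul_le_mul_of_nonneg_left (Finset.sum_le_sum fun σ _ => h σ) (by positivity)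

theorem signMean_const (c : ℝ) : signMean (fun _ : Fin n → ℤˣ => c) = c := by
  have : Fintype.card ℤˣ = 2 := rfl
  simp [signMean, this]

theorem signSum_sub (σ : Fin n → ℤˣ) (u w : Fin n → ℝ) :
    signSum σ (fun i => u i - w i) = signSum σ u - signSum σ w := by
  simp only [signSum, mul_sub, Finset.sum_sub_distrib]

theorem signMean_signSum_const (u : Fin n → ℝ) : signMean (fun σ => signSum σ u) = 0 := by
  have h : ∑ σ : Fin n → ℤˣ, signSum σ u = ∑ σ : Fin n → ℤˣ, -signSum σ u := by
    refine Fintype.sum_equiv (Equiv.neg _) _ _ fun σ => ?_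
    simp [signSum]
  rw [Finset.sum_neg_distrib] at h
  have h0 : ∑ σ : Fin n → ℤˣ, signSum σ u = 0 := by linarith
  rw [signMean, h0, mul_zero]

/-- A Rademacher sum is sub-Gaussian. -/
theorem signMean_exp_signSum_le (u : Fin n → ℝ) (s : ℝ) :
    signMean (fun σ => Real.exp (s * signSum σ u)) ≤ Real.exp (s ^ 2 * (∑ i, u i ^ 2) / 2) := by
  have h1 : ∀ σ : Fin n → ℤˣ, Real.exp (s * signSum σ u) =
      ∏ i, Real.exp (((σ i : ℤ) : ℝ) * (s * u i)) := by
    intro σ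
    rw [← Real.exp_sum, signSum, Finset.mul_sum]
    congr 1
    exact Finset.sum_congr rfl fun i _ => by ring
  have h2 : ∑ σ : Fin n → ℤˣ, ∏ i, Real.exp (((σ i : ℤ) : ℝ) * (s * u i)) =
      ∏ i, ∑ ε : ℤˣ, Real.exp (((ε : ℤ) : ℝ) * (s * u i)) := by
    rw [Finset.prod_univ_sum, Fintype.piFinset_univ]
  have h3 : ∀ x : ℝ, ∑ ε : ℤˣ, Real.exp (((ε : ℤ) : ℝ) * x) = 2 * Real.cosh x := by
    intro x
    have huniv : (Finset.univ : Finset ℤˣ) = {1, -1} := rfl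
    rw [Real.cosh_eq, huniv, Finset.sum_pair (by decide)]
    simp only [Units.val_one, Int.cast_one, one_mul, Units.val_neg, Int.cast_neg, neg_mul]
    ring
  calc signMean (fun σ => Real.exp (s * signSum σ u))
      = ∏ i, Real.cosh (s * u i) := by
        simp only [signMean, h1]
        rw [h2]
        simp only [h3, Finset.prod_mul_distrib, Finset.prod_const, Finset.card_univ,
          Fintype.card_fin]
        field_simp
    _ ≤ ∏ i, Real.exp ((s * u i) ^ 2 / 2) :=
        Finset.prod_le_prod (fun i _ => (Real.cosh_pos _).le) fun i _ =>
          Real.cosh_le_exp_half_sq _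
    _ = _ := by
        rw [← Real.exp_sum]
        congr 1
        rw [Finset.mul_sum, Finset.sum_div]
        exact Finset.sum_congr rfl fun i _ => by ring

/-- Massart's maximal inequality for a finite set of vectors. The maximum is expressed through
an arbitrary choice of a vector for each `σ`. -/
theorem signMean_signSum_select_le (V : Finset (Fin n → ℝ)) {r W : ℝ} (hr : 0 < r) (hW : 0 < W)
    (hV : ∀ u ∈ V, ∑ i, u i ^ 2 ≤ r ^ 2) (hcard : (V.card : ℝ) ≤ Real.exp W)
    (u : (Fin n → ℤˣ) → Fin n → ℝ) (hu : ∀ σ, u σ ∈ V) :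
    signMean (fun σ => signSum σ (u σ)) ≤ r * √(2 * W) := by
  have hs0 : 0 < √(2 * W) := Real.sqrt_pos.mpr (by positivity)
  have hs2 : √(2 * W) ^ 2 = 2 * W := Real.sq_sqrt (by positivity)
  -- This `s` balances the two terms of `W / s + s r ^ 2 / 2`.
  set s := √(2 * W) / r with hs
  have hsr : s ^ 2 * r ^ 2 = 2 * W := by
    rw [hs, div_pow, hs2]
    field_simp
  have hjensen : Real.exp (s * signMean (fun σ => signSum σ (u σ))) ≤
      signMean (fun σ => Real.exp (s * signSum σ (u σ))) := by
    have h := convexOn_exp.map_sum_le (t := Finset.univ)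
      (w := fun _ : Fin n → ℤˣ => (1 / 2 ^ n : ℝ)) (p := fun σ => s * signSum σ (u σ))
      (fun _ _ => by positivity) (by
        have := signMean_const (n := n) 1
        rw [signMean, Finset.mul_sum] at this
        simpa only [mul_one] using this) (fun _ _ => Set.mem_univ _)
    simp only [smul_eq_mul, ← Finset.mul_sum] at h
    rw [signMean, signMean]
    refine le_trans (le_of_eq ?_) h
    congr 1
    ring
  have hunion : signMean (fun σ => Real.exp (s * signSum σ (u σ))) ≤
      ∑ w ∈ V, signMean (fun σ => Real.exp (s * signSum σ w)) := by
    simp only [signMean]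
    rw [← Finset.mul_sum, Finset.sum_comm]
    gcongr with σ _
    exact Finset.single_le_sum (f := fun w => Real.exp (s * signSum σ w))
      (fun w _ => (Real.exp_pos _).le) (hu σ)
  have hsum : ∑ w ∈ V, signMean (fun σ => Real.exp (s * signSum σ w)) ≤ Real.exp (2 * W) := by
    calc ∑ w ∈ V, signMean (fun σ => Real.exp (s * signSum σ w))
        ≤ ∑ _w ∈ V, Real.exp W := Finset.sum_le_sum fun w hw =>
          (signMean_exp_signSum_le w s).trans (Real.exp_le_exp.mpr (by
            have := mul_le_mul_of_nonneg_left (hV w hw) (sq_nonneg s)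
            linarith))
      _ = V.card * Real.exp W := by rw [Finset.sum_const, nsmul_eq_mul]
      _ ≤ Real.exp W * Real.exp W := by gcongr
      _ = _ := by rw [← Real.exp_add]; ring_nf
  have h1 := Real.exp_le_exp.mp ((hjensen.trans hunion).trans hsum)
  rw [hs, div_mul_eq_mul_div, div_le_iff₀ hr] at h1
  refine le_of_mul_le_mul_left (h1.trans (le_of_eq ?_)) hs0
  linear_combination -r * hs2

theorem sum_mul_le_of_sum_sq_le {a b : Fin n → ℝ} {p q : ℝ} (hp : 0 ≤ p) (hq : 0 ≤ q)
    (ha : ∑ i, a i ^ 2 ≤ p ^ 2) (hb : ∑ i, b i ^ 2 ≤ q ^ 2) : ∑ i, a i * b i ≤ p * q := by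
  refine abs_le_of_sq_le_sq' ?_ (by positivity) |>.2
  calc (∑ i, a i * b i) ^ 2 ≤ (∑ i, a i ^ 2) * ∑ i, b i ^ 2 :=
        Finset.sum_mul_sq_le_sq_mul_sq _ _ _
    _ ≤ p ^ 2 * q ^ 2 := by gcongr
    _ = (p * q) ^ 2 := by ring

/-- The chaining bound, for a choice `f` of an index for each `σ`. The `A j` are nets of the class
at scale `h j` for the empirical `L²`-distance, and `A 0` is a single point. -/
theorem signMean_chaining {ι : Type*} (hn : 0 < n) (v : ι → Fin n → ℝ) {h W : ℕ → ℝ}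
    (hh : ∀ j, 0 < h j) (hW : ∀ j, 0 < W j) (hWm : ∀ j, W j ≤ W (j + 1)) (A : ℕ → Finset ι)
    (hA : ∀ j f, ∃ g ∈ A j, ∑ i, (v f i - v g i) ^ 2 ≤ n * h j ^ 2)
    (hcard : ∀ j, ((A j).card : ℝ) ≤ Real.exp (W j)) {f₀ : ι} (hA0 : A 0 = {f₀}) (N : ℕ)
    (f : (Fin n → ℤˣ) → ι) :
    signMean (fun σ => (1 / n : ℝ) * signSum σ (v (f σ))) ≤
      h N + 2 * ∑ j ∈ Finset.range N, (h (j + 1) + h j) * √(W (j + 1) / n) := by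
  classical
  choose π hπA hπ using hA
  have hn' : (0 : ℝ) < n := by exact_mod_cast hn
  have hsn : 0 < √(n : ℝ) := Real.sqrt_pos.mpr hn'
  have hsn2 : √(n : ℝ) ^ 2 = n := Real.sq_sqrt hn'.le
  have hstep : ∀ j, signMean (fun σ => signSum σ (fun i =>
      v (π (j + 1) (f σ)) i - v (π j (f σ)) i)) ≤
      n * (2 * ((h (j + 1) + h j) * √(W (j + 1) / n))) := by
    intro j
    let V : Finset (Fin n → ℝ) :=
      ((A (j + 1)) ×ˢ (A j)).image fun x i => v x.1 i - v x.2 i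
    -- Only pairs of net points close to a common element of the class are used.
    let V' := V.filter fun u => ∑ i, u i ^ 2 ≤ (√(n : ℝ) * (h (j + 1) + h j)) ^ 2
    have hV' : (V'.card : ℝ) ≤ Real.exp (2 * W (j + 1)) := by
      have h1 : V'.card ≤ (A (j + 1)).card * (A j).card :=
        (Finset.card_filter_le _ _).trans
          (Finset.card_image_le.trans (Finset.card_product _ _).le)
      calc (V'.card : ℝ) ≤ (A (j + 1)).card * (A j).card := by exact_mod_cast h1
        _ ≤ Real.exp (W (j + 1)) * Real.exp (W (j + 1)) := by
            gcongr
            · exact hcard _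
            · exact (hcard _).trans (Real.exp_le_exp.mpr (hWm j))
        _ = _ := by rw [← Real.exp_add]; ring_nf
    have h2 := signMean_signSum_select_le V' (r := √(n : ℝ) * (h (j + 1) + h j))
      (W := 2 * W (j + 1)) (by have := hh j; have := hh (j + 1); positivity)
      (by have := hW (j + 1); positivity)
      (fun u hu => (Finset.mem_filter.mp hu).2) hV'
      (fun σ i => v (π (j + 1) (f σ)) i - v (π j (f σ)) i) (fun σ => by
        refine Finset.mem_filter.mpr ⟨Finset.mem_image.mpr ⟨(π (j + 1) (f σ), π j (f σ)),
          Finset.mem_product.mpr ⟨hπA _ _, hπA _ _⟩, rfl⟩, ?_⟩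
        have ha := hπ (j + 1) (f σ)
        have hb := hπ j (f σ)
        rw [← hsn2, ← mul_pow] at ha hb
        have hc := sum_mul_le_of_sum_sq_le (a := fun i => v (π (j + 1) (f σ)) i - v (f σ) i)
          (b := fun i => v (f σ) i - v (π j (f σ)) i)
          (mul_nonneg hsn.le (hh (j + 1)).le) (mul_nonneg hsn.le (hh j).le)
          (le_trans (le_of_eq (Finset.sum_congr rfl fun i _ => by ring)) ha) hb
        have he : ∑ i, (v (π (j + 1) (f σ)) i - v (π j (f σ)) i) ^ 2 =
            ∑ i, (v (f σ) i - v (π (j + 1) (f σ)) i) ^ 2 +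
            ∑ i, (v (f σ) i - v (π j (f σ)) i) ^ 2 +
            2 * ∑ i, (v (π (j + 1) (f σ)) i - v (f σ) i) * (v (f σ) i - v (π j (f σ)) i) := by
          rw [Finset.mul_sum, ← Finset.sum_add_distrib, ← Finset.sum_add_distrib]
          exact Finset.sum_congr rfl fun i _ => by ring
        rw [he]
        linarith)
    refine h2.trans (le_of_eq ?_)
    rw [show 2 * (2 * W (j + 1)) = 2 ^ 2 * W (j + 1) by ring, Real.sqrt_mul (by positivity),
      Real.sqrt_sq (by norm_num), Real.sqrt_div (hW _).le]
    have : √(n : ℝ) * √(n : ℝ) = n := Real.mul_self_sqrt hn'.le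
    nth_rewrite 2 [← this]
    field_simp
  have htel : ∀ M, signMean (fun σ => signSum σ (v (π M (f σ)))) ≤
      n * (2 * ∑ j ∈ Finset.range M, (h (j + 1) + h j) * √(W (j + 1) / n)) := by
    intro M
    induction M with
    | zero =>
      have : ∀ σ, π 0 (f σ) = f₀ := fun σ => by
        have := hπA 0 (f σ)
        rwa [hA0, Finset.mem_singleton] at this
      simp only [this, signMean_signSum_const]
      simp
    | succ M ih =>
      have h1 : signMean (fun σ => signSum σ (v (π (M + 1) (f σ)))) =
          signMean (fun σ => signSum σ (v (π M (f σ)))) + signMean (fun σ => signSum σ (fun i =>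
            v (π (M + 1) (f σ)) i - v (π M (f σ)) i)) := by
        rw [← signMean_add]
        congr 1
        funext σ
        rw [signSum_sub]
        ring
      rw [h1, Finset.sum_range_succ]
      have := hstep M
      linarith
  have hlast : signMean (fun σ => signSum σ (fun i => v (f σ) i - v (π N (f σ)) i)) ≤
      n * h N := by
    rw [← signMean_const (n := n) (n * h N)]
    refine signMean_mono fun σ => ?_
    have hb := hπ N (f σ)
    rw [← hsn2, ← mul_pow] at hb
    have := sum_mul_le_of_sum_sq_le (a := fun i => ((σ i : ℤ) : ℝ)) (p := √(n : ℝ)) hsn.le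
      (mul_nonneg hsn.le (hh N).le) (by
        rw [hsn2]
        have : ∀ i, (((σ i : ℤ) : ℝ)) ^ 2 = 1 := fun i => by
          rcases Int.units_eq_one_or (σ i) with h | h <;> simp [h]
        simp [this]) hb
    refine this.trans (le_of_eq ?_)
    rw [← mul_assoc, ← sq, hsn2]
  have hsplit : signMean (fun σ => (1 / n : ℝ) * signSum σ (v (f σ))) =
      1 / n * (signMean (fun σ => signSum σ (v (π N (f σ)))) +
        signMean (fun σ => signSum σ (fun i => v (f σ) i - v (π N (f σ)) i))) := by
    rw [← signMean_add]
    simp only [signMean, ← Finset.mul_sum]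
    rw [mul_left_comm]
    congr 3
    funext σ
    rw [signSum_sub]
    ring
  rw [hsplit, div_mul_eq_mul_div, one_mul, div_le_iff₀ hn']
  have := htel N
  linarith

end Chaining

/-- It suffices to bound the mean along arbitrary choices of a function for each `σ`. -/
theorem empiricalRademacher_image_le {ι T : Type*} {n : ℕ} {G : Set ι} (hG : G.Nonempty)
    (Φ : ι → T → ℝ) (t : Fin n → T) {B : ℝ}
    (hB : ∀ g : (Fin n → ℤˣ) → G,
      signMean (fun σ => (1 / n : ℝ) * signSum σ fun i => Φ (g σ) (t i)) ≤ B) :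
    empiricalRademacher (Φ '' G) t ≤ B := by
  refine le_of_forall_pos_le_add fun η hη => ?_
  have : Nonempty (Φ '' G) := (hG.image Φ).to_subtype
  have hex : ∀ σ : Fin n → ℤˣ, ∃ g : G, (⨆ f : Φ '' G, (1 / n : ℝ) *
      ∑ i, ((σ i : ℤ) : ℝ) * (f : T → ℝ) (t i)) ≤
      (1 / n : ℝ) * (signSum σ fun i => Φ g (t i)) + η := by
    intro σ
    obtain ⟨⟨_, g, hg, rfl⟩, hf⟩ := exists_lt_of_lt_ciSup
      (show (⨆ f : Φ '' G, (1 / n : ℝ) * ∑ i, ((σ i : ℤ) : ℝ) * (f : T → ℝ) (t i)) - η <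
        ⨆ f : Φ '' G, (1 / n : ℝ) * ∑ i, ((σ i : ℤ) : ℝ) * (f : T → ℝ) (t i) by linarith)
    refine ⟨⟨g, hg⟩, ?_⟩
    simp only [signSum]
    linarith
  choose g hg using hex
  calc empiricalRademacher (Φ '' G) t
      ≤ signMean (fun σ => (1 / n : ℝ) * (signSum σ fun i => Φ (g σ) (t i)) + η) :=
        signMean_mono hg
    _ ≤ B + η := by
        rw [signMean_add, signMean_const]
        linarith [hB g]

/-- A maximal separated set is a net. -/
theorem exists_net_of_separated_card_le {ι : Type*} {sep : ι → ι → Prop}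
    (hirrefl : ∀ f, ¬ sep f f) (hsymm : ∀ f g, sep f g → sep g f) {B : ℝ}
    (hB : ∀ A : Finset ι, (∀ f ∈ A, ∀ g ∈ A, f ≠ g → sep f g) → (A.card : ℝ) ≤ B) :
    ∃ A : Finset ι, (A.card : ℝ) ≤ B ∧ ∀ f, ∃ g ∈ A, ¬ sep f g := by
  classical
  let S : Set ℕ := {k | ∃ A : Finset ι, (∀ f ∈ A, ∀ g ∈ A, f ≠ g → sep f g) ∧ A.card = k}
  have hne : S.Nonempty := ⟨0, ∅, by simp, rfl⟩
  have hbdd : BddAbove S := by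
    refine ⟨⌊B⌋₊, ?_⟩
    rintro k ⟨A, hA, rfl⟩
    exact Nat.le_floor (hB A hA)
  obtain ⟨A, hA, hAc⟩ := Nat.sSup_mem hne hbdd
  refine ⟨A, hB A hA, fun f => ?_⟩
  by_contra! hcon
  have hfA : f ∉ A := fun h => hirrefl f (hcon f h)
  have hmem : (insert f A).card ∈ S := by
    refine ⟨insert f A, ?_, rfl⟩
    intro x hx y hy hxy
    rcases Finset.mem_insert.mp hx with rfl | hx' <;> rcases Finset.mem_insert.mp hy with rfl | hy'
    · exact absurd rfl hxy
    · exact hcon y hy'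
    · exact hsymm _ _ (hcon x hx')
    · exact hA x hx' y hy' hxy
  have := le_csSup hbdd hmem
  rw [Finset.card_insert_of_notMem hfA, ← hAc] at this
  omega

/-- A uniform nonnegative bound passes to the outer expectation. The junk value `0` of the infimum
of an unbounded set does no harm as the bound is nonnegative. -/
theorem outerExpectation_le_of_le {Ω : Type*} [MeasurableSpace Ω] {μ : Measure Ω}
    [IsProbabilityMeasure μ] {φ : Ω → ℝ} {B : ℝ} (hB : 0 ≤ B) (h : ∀ ω, φ ω ≤ B) :
    outerExpectation μ φ ≤ B := by
  have hmem : B ∈ {r | ∃ ψ : Ω → ℝ, Integrable ψ μ ∧ (∀ ω, φ ω ≤ ψ ω) ∧ r = ∫ ω, ψ ω ∂μ} :=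
    ⟨fun _ => B, integrable_const B, h, by simp⟩
  by_cases hb : BddBelow {r | ∃ ψ : Ω → ℝ, Integrable ψ μ ∧ (∀ ω, φ ω ≤ ψ ω) ∧ r = ∫ ω, ψ ω ∂μ}
  · exact csInf_le hb hmem
  · rw [outerExpectation, Real.sInf_of_not_bddBelow hb]
    exact hB

/-! ### Margin functions and the margin Natarajan dimension -/

section Margin

variable {X : Type*} {C : ℕ}

theorem squash_mem_Icc {γ : ℝ} (hγ : 0 < γ) (t : ℝ) : squash γ t ∈ Set.Icc 0 γ := by
  rw [squash]
  split_ifs <;> constructor <;> linarith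

theorem le_of_pos_le_squash {γ t u : ℝ} (hu : 0 < u) (h : u ≤ squash γ t) : u ≤ t := by
  rw [squash] at h
  split_ifs at h <;> linarith

theorem max_zero_le_of_squash_le {γ t u : ℝ} (hu : u < γ) (h : squash γ t ≤ u) :
    max t 0 ≤ u := by
  rw [squash] at h
  rw [max_le_iff]
  split_ifs at h <;> constructor <;> linarith

/-- For a runner-up category `c`, the margin at `(x, c)` is at least minus the positive part of the
margin at `(x, y)`: a small margin on the label is a large one on some other category. -/
theorem exists_neg_max_le_marginFun (hC : 2 ≤ C) (g : X → Fin C → ℝ) (z : X × Fin C) :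
    ∃ c, c ≠ z.2 ∧ -max (marginFun g z) 0 ≤ marginFun g (z.1, c) := by
  have hne : ∀ k : Fin C, Nonempty {l : Fin C // l ≠ k} := by
    intro k
    have : Nontrivial (Fin C) := Fin.nontrivial_iff_two_le.mpr hC
    obtain ⟨l, hl⟩ := exists_ne k
    exact ⟨⟨l, hl⟩⟩
  have := hne z.2
  obtain ⟨⟨c, hc⟩, hmax⟩ :=
    exists_eq_ciSup_of_finite (f := fun l : {l : Fin C // l ≠ z.2} => g z.1 l)
  refine ⟨c, hc, ?_⟩
  have := hne c
  have h1 : (⨆ l : {l : Fin C // l ≠ c}, g z.1 l) ≤ max (g z.1 z.2) (g z.1 c) := by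
    refine ciSup_le fun l => ?_
    by_cases hl : (l : Fin C) = z.2
    · rw [hl]
      exact le_max_left _ _
    · refine le_trans ?_ (le_max_right _ _)
      have h2 : g z.1 c = _ := hmax
      rw [h2]
      exact le_ciSup (f := fun l : {l : Fin C // l ≠ z.2} => g z.1 l)
        (Set.finite_range _).bddAbove ⟨l, hl⟩
  simp only [marginFun]
  rw [← hmax]
  rcases le_total (g z.1 z.2) (g z.1 c) with h | h
  · rw [max_eq_right h] at h1
    have := le_max_right (1 / 2 * (g z.1 z.2 - g z.1 c)) 0
    linarith
  · rw [max_eq_left h] at h1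
    have := le_max_left (1 / 2 * (g z.1 z.2 - g z.1 c)) 0
    linarith

theorem F₁_pos {dC dγ K₁ K₂ : ℝ} (hC : 0 < C) (hK₁ : 0 < K₁) (hK₂ : 0 < K₂) :
    0 < F₁ C dC dγ K₁ K₂ := by
  have : (0 : ℝ) < C := by exact_mod_cast hC
  rw [F₁]
  positivity

/-- The cardinality of a set Natarajan-shattered at margin `ε / 12` is at most `F₁(C) ε ^ (-dγ)`. -/
theorem card_le_of_psiShatters {G : Set (X → Fin C → ℝ)} {M dC dγ K₁ K₂ ε : ℝ}
    (hK₁ : 0 < K₁) (hK₂ : 0 < K₂) (hG : HasPolynomialDimensions G M dC dγ K₁ K₂) (hε : 0 < ε)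
    (hεM : ε ≤ M) {s : Finset (X × Fin C)}
    (hs : PsiShatters (natarajanFamily C) (marginClass G) (ε / 12) s) :
    (s.card : ℝ) ≤ F₁ C dC dγ K₁ K₂ * ε ^ (-dγ) := by
  have h1 : (s.card : ℕ∞) ≤ natarajanDim (ε / 12) (marginClass G) :=
    le_iSup₂ (f := fun (s : Finset (X × Fin C))
      (_ : PsiShatters (natarajanFamily C) (marginClass G) (ε / 12) s) => (s.card : ℕ∞)) s hs
  have h2 : (s.card : ℝ≥0∞) ≤ ((natarajanDim (ε / 12) (marginClass G) : ℕ∞) : ℝ≥0∞) := by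
    have := ENat.toENNReal_mono h1
    simpa using this
  have h3 : (s.card : ℝ≥0∞) ≤ ENNReal.ofReal (K₁ * (C : ℝ) ^ dC) *
      ENNReal.ofReal (K₂ * (ε / 12) ^ (-dγ)) :=
    (h2.trans (hG.natarajanDim_le (ε / 12) (by positivity) (by linarith))).trans
      (mul_le_mul_right (hG.fatDim_le (ε / 12) (by positivity) (by linarith)) _)
  rw [← ENNReal.ofReal_mul (by positivity), ← ENNReal.ofReal_natCast,
    ENNReal.ofReal_le_ofReal_iff (by positivity)] at h3
  refine h3.trans (le_of_eq ?_)
  rw [Real.div_rpow hε.le (by norm_num), Real.rpow_neg (x := 12) (by norm_num), F₁]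
  field_simp

/-- Entropy bound for the squashed margin class on a sample, at a scale below `γ`. -/
theorem log_card_le_of_margin_separated (hC : 3 ≤ C) {G : Set (X → Fin C → ℝ)}
    {M dC dγ K₁ K₂ γ ε : ℝ} (hM : 1 ≤ M) (hK₁ : 0 < K₁) (hK₂ : 0 < K₂)
    (hG : HasPolynomialDimensions G M dC dγ K₁ K₂) (hγ1 : γ ≤ 1) (hε : 0 < ε)
    (hεγ : ε ≤ γ) {n : ℕ} (hn : 0 < n) (t : Fin n → X × Fin C) {A : Finset G} (hA : 2 ≤ A.card)
    (hsep : ∀ f ∈ A, ∀ g ∈ A, f ≠ g → n * ε ^ 2 ≤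
      ∑ i, (squash γ (marginFun f.1 (t i)) - squash γ (marginFun g.1 (t i))) ^ 2) :
    Real.log A.card ≤ 25 / 4 * (F₁ C dC dγ K₁ K₂ * ε ^ (-dγ)) *
      Real.log (((C : ℝ) - 1) * (6 * (γ / ε)) ^ 5) ^ 2 := by
  have hγ : 0 < γ := hε.trans_le hεγ
  have hC' : (3 : ℝ) ≤ C := by exact_mod_cast hC
  choose κ hκ hκm using fun g : G => exists_neg_max_le_marginFun (by omega : 2 ≤ C) g.1
  have : Nonempty (Fin C) := ⟨⟨0, by omega⟩⟩
  refine log_card_le_of_separated (fun (g : G) z => squash γ (marginFun g.1 z)) κ hε hεγ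
    (fun (f : G) z => squash_mem_Icc hγ (marginFun f.1 z)) (by linarith)
    (by rw [Fintype.card_fin]; linarith) hn t hA
    hsep fun s b c hs => ?_
  refine card_le_of_psiShatters hK₁ hK₂ hG hε (by linarith) ?_
  have hb : ∀ z ∈ s, 0 ≤ b z - ε / 12 ∧ b z + ε / 12 ≤ γ ∧ c z ≠ z.2 := by
    intro z hz
    obtain ⟨f, -, hf⟩ := hs fun _ => true
    obtain ⟨g, -, hg⟩ := hs fun _ => false
    have h1 := (hf z hz).1 rfl
    obtain ⟨h2, h3⟩ := (hg z hz).2 rfl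
    refine ⟨(squash_mem_Icc hγ _).1.trans h2, h1.trans (squash_mem_Icc hγ _).2, ?_⟩
    rw [← h3]
    exact hκ g z
  refine ⟨fun z y => if y = z.2 then 1 else if y = c z then -1 else 0,
    fun z hz => ⟨⟨z.2, c z, (hb z hz).2.2.symm, rfl⟩, by simp⟩, b, fun σ => ?_⟩
  obtain ⟨f, -, hf⟩ := hs fun z => decide (σ z = 1)
  refine ⟨marginFun f.1, ⟨f.1, f.2, rfl⟩, fun z hz => ⟨fun hσ => ?_, fun hσ => ?_⟩⟩
  · have h1 := (hf z hz).1 (by simp [hσ])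
    refine ⟨z.2, by simp, ?_⟩
    have h2 := le_of_pos_le_squash (by linarith [(hb z hz).1]) h1
    linarith
  · obtain ⟨h1, h2⟩ := (hf z hz).2 (by rw [hσ]; decide)
    refine ⟨c z, by simp [(hb z hz).2.2], ?_⟩
    have h3 := max_zero_le_of_squash_le (by linarith [(hb z hz).2.1]) h1
    have h4 := hκm f z
    rw [h2] at h4
    linarith

/-- Nets of the squashed margin class. Above the scale `γ` one point is enough. -/
theorem exists_margin_net (hC : 3 ≤ C) {G : Set (X → Fin C → ℝ)}
    {M dC dγ K₁ K₂ γ ε : ℝ} (hM : 1 ≤ M) (hK₁ : 0 < K₁) (hK₂ : 0 < K₂)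
    (hG : HasPolynomialDimensions G M dC dγ K₁ K₂) (hγ : 0 < γ) (hγ1 : γ ≤ 1) (hε : 0 < ε)
    {n : ℕ} (hn : 0 < n) (t : Fin n → X × Fin C) (g₀ : G) {ℓ : ℝ}
    (hℓ : ε ≤ γ → Real.log (((C : ℝ) - 1) * (6 * (γ / ε)) ^ 5) ≤ ℓ) :
    ∃ A : Finset G, (γ ≤ ε → A = {g₀}) ∧
      (A.card : ℝ) ≤ Real.exp (25 / 4 * (F₁ C dC dγ K₁ K₂ * ε ^ (-dγ)) * ℓ ^ 2) ∧
      ∀ f : G, ∃ g ∈ A, ∑ i, (squash γ (marginFun f.1 (t i)) - squash γ (marginFun g.1 (t i))) ^ 2 ≤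
        n * ε ^ 2 := by
  have hF := F₁_pos (C := C) (dC := dC) (dγ := dγ) (by omega) hK₁ hK₂
  have hn' : (0 : ℝ) < n := by exact_mod_cast hn
  rcases le_or_gt γ ε with h | h
  · refine ⟨{g₀}, fun _ => rfl, ?_, fun f => ⟨g₀, Finset.mem_singleton_self _, ?_⟩⟩
    · simp only [Finset.card_singleton, Nat.cast_one]
      exact Real.one_le_exp (by positivity)
    · calc _ ≤ ∑ _i : Fin n, ε ^ 2 := Finset.sum_le_sum fun i _ => by
            obtain ⟨h1, h2⟩ := squash_mem_Icc hγ (marginFun f.1 (t i))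
            obtain ⟨h3, h4⟩ := squash_mem_Icc hγ (marginFun g₀.1 (t i))
            exact sq_le_sq' (by linarith) (by linarith)
        _ = n * ε ^ 2 := by simp
  · have hC' : (3 : ℝ) ≤ C := by exact_mod_cast hC
    have hL : 0 ≤ Real.log (((C : ℝ) - 1) * (6 * (γ / ε)) ^ 5) := by
      have := nine_le_log (K := (C : ℝ) - 1) (e := ε / γ) (by linarith) (by positivity)
        ((div_le_one hγ).mpr h.le)
      rw [one_div_div] at this
      linarith
    obtain ⟨A, hA, hnet⟩ := exists_net_of_separated_card_le
      (sep := fun f g : G => n * ε ^ 2 ≤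
        ∑ i, (squash γ (marginFun f.1 (t i)) - squash γ (marginFun g.1 (t i))) ^ 2)
      (fun f hf => by
        simp only [sub_self, ne_eq, OfNat.ofNat_ne_zero, not_false_eq_true, zero_pow,
          Finset.sum_const_zero] at hf
        have : 0 < n * ε ^ 2 := by positivity
        linarith)
      (fun f g hfg => hfg.trans (le_of_eq (Finset.sum_congr rfl fun i _ => by ring)))
      (B := Real.exp (25 / 4 * (F₁ C dC dγ K₁ K₂ * ε ^ (-dγ)) * ℓ ^ 2))
      (fun A hA => by
        rcases Nat.lt_or_ge A.card 2 with h2 | h2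
        · have h3 : (A.card : ℝ) ≤ 1 := by exact_mod_cast Nat.le_of_lt_succ h2
          exact h3.trans (Real.one_le_exp (by positivity))
        · have h3 := log_card_le_of_margin_separated hC hM hK₁ hK₂ hG hγ1 hε h.le hn t h2 hA
          have h4 : (0 : ℝ) < A.card := by
            have : 0 < A.card := by omega
            exact_mod_cast this
          rw [← Real.log_le_iff_le_exp h4]
          refine h3.trans ?_
          have := hℓ h.le
          gcongr)
    refine ⟨A, fun h' => absurd h' (not_le.mpr h), hA, fun f => ?_⟩
    obtain ⟨g, hg, hfg⟩ := hnet f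
    exact ⟨g, hg, (not_le.mp hfg).le⟩

/-- The chaining bound for the squashed margin class along the scales `h 0 ≥ γ`, `h 1`, …, `h N`. -/
theorem empiricalRademacher_squashedMarginClass_le (hC : 3 ≤ C) {G : Set (X → Fin C → ℝ)}
    {M dC dγ K₁ K₂ γ : ℝ} (hM : 1 ≤ M) (hdγ : 0 < dγ) (hK₁ : 0 < K₁) (hK₂ : 0 < K₂)
    (hG : HasPolynomialDimensions G M dC dγ K₁ K₂) (hγ : 0 < γ) (hγ1 : γ ≤ 1)
    {n : ℕ} (hn : 0 < n) (t : Fin n → X × Fin C) {h ℓ : ℕ → ℝ} (hh : ∀ j, 0 < h j)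
    (hanti : ∀ j, h (j + 1) ≤ h j) (h0 : γ ≤ h 0) (hℓ0 : ∀ j, 0 < ℓ j)
    (hℓm : ∀ j, ℓ j ≤ ℓ (j + 1))
    (hℓ : ∀ j, h j ≤ γ → Real.log (((C : ℝ) - 1) * (6 * (γ / h j)) ^ 5) ≤ ℓ j) (N : ℕ) :
    empiricalRademacher (squashedMarginClass G γ) t ≤ h N + 5 * √(F₁ C dC dγ K₁ K₂ / n) *
      ∑ j ∈ Finset.range N, (h (j + 1) + h j) * h (j + 1) ^ (-(dγ / 2)) * ℓ (j + 1) := by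
  have hF := F₁_pos (C := C) (dC := dC) (dγ := dγ) (by omega) hK₁ hK₂
  have hn' : (0 : ℝ) < n := by exact_mod_cast hn
  rcases G.eq_empty_or_nonempty with rfl | hne
  · have h1 : empiricalRademacher (squashedMarginClass (∅ : Set (X → Fin C → ℝ)) γ) t = 0 := by
      have : squashedMarginClass (∅ : Set (X → Fin C → ℝ)) γ = ∅ := by simp [squashedMarginClass]
      rw [this]
      simp [empiricalRademacher, Real.iSup_of_isEmpty]
    rw [h1]
    have h2 : 0 ≤ ∑ j ∈ Finset.range N,
        (h (j + 1) + h j) * h (j + 1) ^ (-(dγ / 2)) * ℓ (j + 1) :=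
      Finset.sum_nonneg fun j _ => by
        have := hh j
        have := hh (j + 1)
        have := hℓ0 (j + 1)
        positivity
    have := hh N
    positivity
  · obtain ⟨g₀, hg₀⟩ := hne
    choose A hA0 hAc hAn using fun j =>
      exists_margin_net hC hM hK₁ hK₂ hG hγ hγ1 (hh j) hn t ⟨g₀, hg₀⟩ (hℓ j)
    refine empiricalRademacher_image_le ⟨g₀, hg₀⟩ _ t fun g => ?_
    have hchain := signMean_chaining hn (fun (f : G) i => squash γ (marginFun f.1 (t i))) hh
      (W := fun j => 25 / 4 * (F₁ C dC dγ K₁ K₂ * h j ^ (-dγ)) * ℓ j ^ 2)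
      (fun j => by
        have := hh j
        have := hℓ0 j
        positivity)
      (fun j => by
        have h1 := Real.rpow_le_rpow_of_nonpos (hh (j + 1)) (hanti j)
          (by linarith : -dγ ≤ 0)
        have h2 := hℓm j
        have h3 := (hℓ0 j).le
        have := hh (j + 1)
        gcongr) A hAn hAc (hA0 0 h0) N g
    refine hchain.trans (le_of_eq ?_)
    rw [Finset.mul_sum, Finset.mul_sum]
    congr 1
    refine Finset.sum_congr rfl fun j _ => ?_
    have hj := hh (j + 1)
    have hs : √(25 / 4 * (F₁ C dC dγ K₁ K₂ * h (j + 1) ^ (-dγ)) * ℓ (j + 1) ^ 2 / n) =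
        5 / 2 * √(F₁ C dC dγ K₁ K₂ / n) * h (j + 1) ^ (-(dγ / 2)) * ℓ (j + 1) := by
      have h1 : h (j + 1) ^ (-dγ) = (h (j + 1) ^ (-(dγ / 2))) ^ 2 := by
        rw [sq, ← Real.rpow_add hj]
        ring_nf
      have h2 : √(F₁ C dC dγ K₁ K₂ / n) ^ 2 = F₁ C dC dγ K₁ K₂ / n :=
        Real.sq_sqrt (by positivity)
      have h3 : 25 / 4 * (F₁ C dC dγ K₁ K₂ * h (j + 1) ^ (-dγ)) * ℓ (j + 1) ^ 2 / n =
          (5 / 2 * √(F₁ C dC dγ K₁ K₂ / n) * h (j + 1) ^ (-(dγ / 2)) * ℓ (j + 1)) ^ 2 := by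
        rw [mul_pow, mul_pow, mul_pow, h2, h1]
        ring
      rw [h3, Real.sqrt_sq]
      have := hℓ0 (j + 1)
      positivity
    rw [hs]
    ring

end Margin

/-! ### The choice of the scales -/

theorem logb_two_lt_self {x : ℝ} (hx : 0 < x) : Real.logb 2 x < x := by
  have l1 := Real.log_two_gt_d9
  have l2 := Real.log_two_lt_d9
  rw [Real.logb, div_lt_iff₀ (by linarith)]
  have h := Real.log_le_sub_one_of_pos (show 0 < x / 2 by positivity)
  rw [Real.log_div hx.ne' (by norm_num)] at h
  nlinarith

theorem sum_half_pow_mul (a b : ℝ) (N : ℕ) :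
    ∑ j ∈ Finset.range N, (1 / 2 : ℝ) ^ (j + 1) * (a + b * (j + 1)) =
      a * (1 - (1 / 2) ^ N) + b * (2 - (N + 2) * (1 / 2) ^ N) := by
  induction N with
  | zero => simp
  | succ N ih =>
    rw [Finset.sum_range_succ, ih]
    push_cast
    ring

/-- Along geometric scales the integrand of the chaining bound is geometric. -/
theorem add_mul_rpow_mul_pow {x c y a : ℝ} (hx : 0 < x) (hc : 0 < c) (k : ℕ) :
    (c * x ^ k + y * (c * x ^ k)) * (c * x ^ k) ^ (-a) =
      (1 + y) * c ^ (1 - a) * (x ^ (1 - a)) ^ k := by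
  have hk : 0 < c * x ^ k := by positivity
  have h1 : c * x ^ k * (c * x ^ k) ^ (-a) = (c * x ^ k) ^ (1 - a) := by
    rw [sub_eq_add_neg, Real.rpow_add hk, Real.rpow_one]
  have h2 : (x ^ k) ^ (1 - a) = (x ^ (1 - a)) ^ k := by
    rw [← Real.rpow_natCast, ← Real.rpow_natCast, ← Real.rpow_mul hx.le, ← Real.rpow_mul hx.le,
      mul_comm]
  calc _ = (1 + y) * (c * x ^ k * (c * x ^ k) ^ (-a)) := by ring
    _ = _ := by rw [h1, Real.mul_rpow hc.le (by positivity), h2, mul_assoc]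

theorem F₂_pos {C : ℕ} (hC : 3 ≤ C) {dγ : ℝ} (hd : dγ < 2) : 0 < F₂ C dγ := by
  have hC' : (3 : ℝ) ≤ C := by exact_mod_cast hC
  have h1 : 0 ≤ Real.log (√((C : ℝ) - 1)) :=
    Real.log_nonneg (Real.one_le_sqrt.mpr (by linarith))
  have h2 : 0 ≤ Real.log (√6) := Real.log_nonneg (Real.one_le_sqrt.mpr (by norm_num))
  have h3 : 0 < (1 + Real.log 2) / (2 - dγ) :=
    div_pos (by linarith [Real.log_two_gt_d9]) (by linarith)
  rw [F₂]
  linarith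

section Scales

variable {X : Type*} {C : ℕ} {G : Set (X → Fin C → ℝ)} {M dC dγ K₁ K₂ γ : ℝ} {m : ℕ}

/-- For `dγ < 2` the entropy integral converges at `0`, and no smallest scale is needed. -/
theorem empiricalRademacher_le_of_lt_two (hC : 3 ≤ C) (hM : 1 ≤ M) (hdγ : 0 < dγ)
    (hK₁ : 0 < K₁) (hK₂ : 0 < K₂) (hG : HasPolynomialDimensions G M dC dγ K₁ K₂) (hγ : 0 < γ)
    (hγ1 : γ ≤ 1) (hm : 1 ≤ m) (hd : dγ < 2) (t : Fin m → X × Fin C) :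
    empiricalRademacher (squashedMarginClass G γ) t ≤
      10 * (1 + (2 : ℝ) ^ (2 / (2 - dγ))) * √(F₁ C dC dγ K₁ K₂ / m) * F₂ C dγ *
        γ ^ (1 - dγ / 2) := by
  have hC' : (3 : ℝ) ≤ C := by exact_mod_cast hC
  have l2 := Real.log_two_gt_d9
  have l2' := Real.log_two_lt_d9
  have hd2 : 0 < 2 - dγ := by linarith
  -- The scales are `γ x ^ j`; the exponent `p` is such that `x ^ (1 - dγ / 2) = 1 / 2`.
  set p := 2 / (2 - dγ) with hp
  have hp0 : 0 < p := by positivity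
  set x : ℝ := 2 ^ (-p) with hx
  have hx0 : 0 < x := by positivity
  have hx1 : x < 1 := Real.rpow_lt_one_of_one_lt_of_neg (by norm_num) (by linarith)
  have hxy : (2 : ℝ) ^ p * x = 1 := by
    rw [hx, ← Real.rpow_add (by norm_num), add_neg_cancel, Real.rpow_zero]
  have hxa : x ^ (1 - dγ / 2) = 1 / 2 := by
    rw [hx, ← Real.rpow_mul (by norm_num)]
    have : -p * (1 - dγ / 2) = -1 := by
      rw [hp]
      field_simp
    rw [this, Real.rpow_neg_one, one_div]
  set a := Real.log ((C : ℝ) - 1) + 5 * Real.log 6 with ha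
  set b := 5 * p * Real.log 2 with hb
  have ha0 : 0 < a := by
    have h1 : 0 < Real.log ((C : ℝ) - 1) := Real.log_pos (by linarith)
    have h2 : 0 < Real.log 6 := Real.log_pos (by norm_num)
    rw [ha]
    positivity
  have hb0 : 0 < b := by positivity
  have hF2 : a + 2 * b ≤ 2 * F₂ C dγ := by
    rw [F₂, Real.log_sqrt (by linarith), Real.log_sqrt (by norm_num), ha, hb]
    have h1 : p * (2 * Real.log 2) ≤ p * (1 + Real.log 2) := by gcongr; linarith
    have h2 : (1 + Real.log 2) / (2 - dγ) = p * (1 + Real.log 2) / 2 := by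
      rw [hp]
      field_simp
    rw [h2]
    linarith
  have hbound : ∀ N : ℕ, empiricalRademacher (squashedMarginClass G γ) t ≤
      γ * x ^ N + 10 * (1 + (2 : ℝ) ^ p) * √(F₁ C dC dγ K₁ K₂ / m) * F₂ C dγ *
        γ ^ (1 - dγ / 2) := by
    intro N
    have h1 := empiricalRademacher_squashedMarginClass_le hC hM hdγ hK₁ hK₂ hG hγ hγ1 hm t
      (h := fun j => γ * x ^ j) (ℓ := fun j => a + b * j) (fun j => by positivity)
      (fun j => mul_le_mul_of_nonneg_left
        (pow_le_pow_of_le_one hx0.le hx1.le (Nat.le_succ j)) hγ.le)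
      (by simp) (fun j => by positivity)
      (fun j => by
        push_cast
        linarith)
      (fun j _ => by
        apply le_of_eq
        have h2 : γ / (γ * x ^ j) = ((2 : ℝ) ^ p) ^ j := by
          have : ((2 : ℝ) ^ p) ^ j * x ^ j = 1 := by rw [← mul_pow, hxy, one_pow]
          rw [div_eq_iff (by positivity)]
          linear_combination -γ * this
        rw [h2, Real.log_mul (by linarith) (by positivity), Real.log_pow,
          Real.log_mul (by norm_num) (by positivity), Real.log_pow,
          Real.log_rpow (by norm_num)]
        push_cast
        rw [ha, hb]
        ring) N
    refine h1.trans ?_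
    have h3 : ∑ j ∈ Finset.range N, (γ * x ^ (j + 1) + γ * x ^ j) *
        (γ * x ^ (j + 1)) ^ (-(dγ / 2)) * (a + b * ((j + 1 : ℕ) : ℝ)) ≤
        (1 + (2 : ℝ) ^ p) * γ ^ (1 - dγ / 2) * (2 * F₂ C dγ) := by
      calc _ = (1 + (2 : ℝ) ^ p) * γ ^ (1 - dγ / 2) *
            ∑ j ∈ Finset.range N, (1 / 2 : ℝ) ^ (j + 1) * (a + b * (j + 1)) := by
            rw [Finset.mul_sum]
            refine Finset.sum_congr rfl fun j _ => ?_
            have h4 : γ * x ^ j = (2 : ℝ) ^ p * (γ * x ^ (j + 1)) := by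
              rw [pow_succ]
              linear_combination (-γ * x ^ j) * hxy
            rw [h4, add_mul_rpow_mul_pow hx0 hγ, hxa]
            push_cast
            ring
        _ ≤ _ := by
            rw [sum_half_pow_mul]
            gcongr
            refine le_trans ?_ hF2
            have h5 : (0 : ℝ) ≤ (1 / 2) ^ N := by positivity
            have h6 : 0 ≤ a * (1 / 2) ^ N := by positivity
            have h7 : 0 ≤ b * ((N + 2) * (1 / 2) ^ N) := by positivity
            linarith
    have h8 := mul_le_mul_of_nonneg_left h3
      (show 0 ≤ 5 * √(F₁ C dC dγ K₁ K₂ / m) by positivity)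
    linarith
  -- Let the finest scale tend to `0`.
  have hlim : Filter.Tendsto (fun N : ℕ => γ * x ^ N +
      10 * (1 + (2 : ℝ) ^ p) * √(F₁ C dC dγ K₁ K₂ / m) * F₂ C dγ * γ ^ (1 - dγ / 2))
      Filter.atTop (nhds (γ * 0 +
        10 * (1 + (2 : ℝ) ^ p) * √(F₁ C dC dγ K₁ K₂ / m) * F₂ C dγ * γ ^ (1 - dγ / 2))) :=
    ((tendsto_pow_atTop_nhds_zero_of_lt_one hx0.le hx1).const_mul γ).add_const _
  have := ge_of_tendsto' hlim hbound
  rwa [mul_zero, zero_add] at this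

/-- The chaining bound along scales that increase geometrically, with ratio `y`, from the finest
one `γ τ`. -/
theorem empiricalRademacher_le_of_ratio (hC : 3 ≤ C) (hM : 1 ≤ M) (hdγ : 0 < dγ)
    (hK₁ : 0 < K₁) (hK₂ : 0 < K₂) (hG : HasPolynomialDimensions G M dC dγ K₁ K₂) (hγ : 0 < γ)
    (hγ1 : γ ≤ 1) (hm : 1 ≤ m) (t : Fin m → X × Fin C) {τ y : ℝ} (hτ : 0 < τ) (hy : 1 ≤ y) {N : ℕ}
    (hN : 1 ≤ τ * y ^ N) (hℓ : 0 < Real.log (((C : ℝ) - 1) * (6 * (1 / τ)) ^ 5)) :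
    empiricalRademacher (squashedMarginClass G γ) t ≤
      γ * τ + 5 * √(F₁ C dC dγ K₁ K₂ / m) * ((1 + y) * (γ * τ) ^ (1 - dγ / 2) *
        (∑ k ∈ Finset.range N, (y ^ (1 - dγ / 2)) ^ k) *
          Real.log (((C : ℝ) - 1) * (6 * (1 / τ)) ^ 5)) := by
  have hC' : (3 : ℝ) ≤ C := by exact_mod_cast hC
  have hy0 : 0 < y := by linarith
  have hc : 0 < γ * τ := by positivity
  -- The truncated subtraction `N - j` keeps the scale constant beyond `N`.
  have h1 := empiricalRademacher_squashedMarginClass_le hC hM hdγ hK₁ hK₂ hG hγ hγ1 hm t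
    (h := fun j => γ * τ * y ^ (N - j))
    (ℓ := fun _ => Real.log (((C : ℝ) - 1) * (6 * (1 / τ)) ^ 5)) (fun j => by positivity)
    (fun j => mul_le_mul_of_nonneg_left (pow_le_pow_right₀ hy (by omega)) hc.le)
    (by
      rw [Nat.sub_zero, mul_assoc]
      exact le_mul_of_one_le_right hγ.le hN) (fun j => hℓ) (fun j => le_rfl)
    (fun j _ => by
      have h2 : γ / (γ * τ * y ^ (N - j)) ≤ 1 / τ := by
        rw [div_le_div_iff₀ (by positivity) hτ, one_mul]
        exact le_mul_of_one_le_right hc.le (one_le_pow₀ hy)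
      have h3 : 0 < (C : ℝ) - 1 := by linarith
      apply Real.log_le_log (by positivity)
      gcongr) N
  refine h1.trans (le_of_eq ?_)
  rw [Nat.sub_self, pow_zero, mul_one, ← Finset.sum_range_reflect]
  congr 2
  rw [Finset.mul_sum, Finset.sum_mul]
  refine Finset.sum_congr rfl fun j hj => ?_
  have hj' := Finset.mem_range.mp hj
  rw [show N - (N - 1 - j + 1) = j by omega, show N - (N - 1 - j) = j + 1 by omega,
    show γ * τ * y ^ (j + 1) = y * (γ * τ * y ^ j) by ring, add_mul_rpow_mul_pow hy0 hc]

/-- For `dγ = 2` all the scales contribute equally, whence the number of scales as a factor. The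
second conjunct, nonnegativity of the bound, is needed to pass to the outer expectation. -/
theorem empiricalRademacher_le_of_eq_two (hC : 3 ≤ C) (hM : 1 ≤ M) (hdγ : 0 < dγ)
    (hK₁ : 0 < K₁) (hK₂ : 0 < K₂) (hG : HasPolynomialDimensions G M dC dγ K₁ K₂) (hγ : 0 < γ)
    (hγ1 : γ ≤ 1) (hm : 2 ≤ m) (hd : dγ = 2) (t : Fin m → X × Fin C) :
    empiricalRademacher (squashedMarginClass G γ) t ≤
      γ * (Real.logb 2 m / √(m : ℝ)) +
        15 * √(F₁ C dC dγ K₁ K₂ / m) * (⌈Real.logb 2 (√(m : ℝ) / Real.logb 2 m)⌉ : ℝ) *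
          Real.log (((C : ℝ) - 1) * (6 * (√(m : ℝ) / Real.logb 2 m)) ^ 5) ∧
    0 ≤ γ * (Real.logb 2 m / √(m : ℝ)) +
        15 * √(F₁ C dC dγ K₁ K₂ / m) * (⌈Real.logb 2 (√(m : ℝ) / Real.logb 2 m)⌉ : ℝ) *
          Real.log (((C : ℝ) - 1) * (6 * (√(m : ℝ) / Real.logb 2 m)) ^ 5) := by
  have hC' : (3 : ℝ) ≤ C := by exact_mod_cast hC
  have hm' : (2 : ℝ) ≤ m := by exact_mod_cast hm
  have hs : 0 < √(m : ℝ) := Real.sqrt_pos.mpr (by linarith)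
  have hl : 0 < Real.logb 2 m := Real.logb_pos (by norm_num) (by linarith)
  have hlt : Real.logb 2 m < 2 * √(m : ℝ) := by
    have h1 := logb_two_lt_self hs
    have h2 : Real.logb 2 m = 2 * Real.logb 2 (√(m : ℝ)) := by
      rw [← Real.sq_sqrt (show (0 : ℝ) ≤ m by linarith), Real.logb_pow, Real.sqrt_sq hs.le]
      norm_num
    linarith
  set w := √(m : ℝ) / Real.logb 2 m with hw
  have hw0 : 0 < w := by positivity
  -- `w` may be smaller than `1`, but not so small that the ceiling or the logarithm is negative.
  have hw2 : 1 / 2 < w := by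
    rw [hw, lt_div_iff₀ hl]
    linarith
  have hτ : Real.logb 2 m / √(m : ℝ) = 1 / w := by rw [hw, one_div_div]
  have hceil : 0 ≤ ⌈Real.logb 2 w⌉ := by
    have h1 : -1 < Real.logb 2 w := by
      rw [Real.lt_logb_iff_rpow_lt (by norm_num) hw0, Real.rpow_neg_one]
      linarith
    have h2 : (-1 : ℤ) < ⌈Real.logb 2 w⌉ := Int.lt_ceil.mpr (by push_cast; exact h1)
    omega
  have hℓ : 0 < Real.log (((C : ℝ) - 1) * (6 * w) ^ 5) := by
    apply Real.log_pos
    have h1 : 1 ≤ (6 * w) ^ 5 := one_le_pow₀ (by linarith)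
    nlinarith
  rw [hτ]
  refine ⟨?_, ?_⟩
  · obtain ⟨N, hN⟩ := Int.eq_ofNat_of_zero_le hceil
    have hNw : w ≤ 2 ^ N := by
      have h1 : Real.logb 2 w ≤ N := by
        have := Int.le_ceil (Real.logb 2 w)
        rw [hN] at this
        exact_mod_cast this
      rw [Real.logb_le_iff_le_rpow (by norm_num) hw0, Real.rpow_natCast] at h1
      exact h1
    have h2 := empiricalRademacher_le_of_ratio hC hM hdγ hK₁ hK₂ hG hγ hγ1 (by omega : 1 ≤ m) t
      (τ := 1 / w) (y := 2) (N := N) (by positivity) (by norm_num) (by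
        rw [div_mul_eq_mul_div, one_mul, le_div_iff₀ hw0, one_mul]
        exact hNw) (by rwa [one_div_one_div])
    refine h2.trans (le_of_eq ?_)
    have h3 : 1 - dγ / 2 = 0 := by rw [hd]; norm_num
    rw [h3, one_div_one_div, hN]
    simp only [Real.rpow_zero, one_pow, Finset.sum_const, Finset.card_range, nsmul_eq_mul]
    push_cast
    ring
  · have h1 : (0 : ℝ) ≤ (⌈Real.logb 2 w⌉ : ℝ) := by exact_mod_cast hceil
    positivity

/-- For `dγ > 2` the entropy integral diverges at `0`, and the finest scale
`γ (log₂ m / m) ^ (1 / dγ)` governs the bound. -/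
theorem empiricalRademacher_le_of_two_lt (hC : 3 ≤ C) (hM : 1 ≤ M)
    (hK₁ : 0 < K₁) (hK₂ : 0 < K₂) (hG : HasPolynomialDimensions G M dC dγ K₁ K₂) (hγ : 0 < γ)
    (hγ1 : γ ≤ 1) (hm : 2 ≤ m) (hd : 2 < dγ) (t : Fin m → X × Fin C) :
    empiricalRademacher (squashedMarginClass G γ) t ≤
      γ * (Real.logb 2 m / m) ^ (1 / dγ) *
        (1 + 10 * (1 + (2 : ℝ) ^ (2 / (dγ - 2))) * (1 / γ) ^ (dγ / 2) *
          √(F₁ C dC dγ K₁ K₂ / Real.logb 2 m) *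
          Real.log (((C : ℝ) - 1) * (6 * ((m : ℝ) / Real.logb 2 m) ^ (1 / dγ)) ^ 5)) ∧
    0 ≤ γ * (Real.logb 2 m / m) ^ (1 / dγ) *
        (1 + 10 * (1 + (2 : ℝ) ^ (2 / (dγ - 2))) * (1 / γ) ^ (dγ / 2) *
          √(F₁ C dC dγ K₁ K₂ / Real.logb 2 m) *
          Real.log (((C : ℝ) - 1) * (6 * ((m : ℝ) / Real.logb 2 m) ^ (1 / dγ)) ^ 5)) := by
  have hC' : (3 : ℝ) ≤ C := by exact_mod_cast hC
  have hm' : (2 : ℝ) ≤ m := by exact_mod_cast hm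
  have hm0 : (0 : ℝ) < m := by linarith
  have hF := F₁_pos (C := C) (dC := dC) (dγ := dγ) (by omega) hK₁ hK₂
  have hl : 0 < Real.logb 2 m := Real.logb_pos (by norm_num) (by linarith)
  have hlt := logb_two_lt_self hm0
  have hdγ : 0 < dγ := by linarith
  have hd2 : 0 < dγ - 2 := by linarith
  set u := Real.logb 2 m / m with hu
  have hu0 : 0 < u := by positivity
  have hu1 : u ≤ 1 := by rw [hu, div_le_one hm0]; exact hlt.le
  set τ := u ^ (1 / dγ) with hτ
  have hτ0 : 0 < τ := by positivity
  have hτ1 : τ ≤ 1 := Real.rpow_le_one hu0.le hu1 (by positivity)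
  have hinv : ((m : ℝ) / Real.logb 2 m) ^ (1 / dγ) = 1 / τ := by
    rw [hτ, ← one_div_div, ← hu, Real.div_rpow (by norm_num) hu0.le, Real.one_rpow]
  rw [hinv]
  have hℓ : 0 < Real.log (((C : ℝ) - 1) * (6 * (1 / τ)) ^ 5) := by
    have := nine_le_log (K := (C : ℝ) - 1) (by linarith) hτ0 hτ1
    linarith
  refine ⟨?_, by positivity⟩
  -- With this ratio, `y ^ (1 - dγ / 2) = 1 / 2`: the chaining sum is dominated by the finest scale.
  set y : ℝ := 2 ^ (2 / (dγ - 2)) with hy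
  have hy1 : 1 < y := Real.one_lt_rpow (by norm_num) (by positivity)
  have hya : y ^ (1 - dγ / 2) = 1 / 2 := by
    rw [hy, ← Real.rpow_mul (by norm_num)]
    have : 2 / (dγ - 2) * (1 - dγ / 2) = -1 := by
      field_simp
      ring
    rw [this, Real.rpow_neg_one, one_div]
  obtain ⟨N, hN⟩ := pow_unbounded_of_one_lt (1 / τ) hy1
  rw [div_lt_iff₀ hτ0] at hN
  have h1 := empiricalRademacher_le_of_ratio hC hM hdγ hK₁ hK₂ hG hγ hγ1 (by omega : 1 ≤ m) t
    hτ0 hy1.le (N := N) (by linarith) hℓ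
  refine h1.trans ?_
  have hsum : ∑ k ∈ Finset.range N, (y ^ (1 - dγ / 2)) ^ k ≤ 2 := by
    rw [hya, geom_sum_eq (by norm_num)]
    have : (0 : ℝ) ≤ (1 / 2) ^ N := by positivity
    rw [div_le_iff_of_neg (by norm_num)]
    linarith
  have hpow : √(F₁ C dC dγ K₁ K₂ / m) * (γ * τ) ^ (1 - dγ / 2) =
      γ * τ * ((1 / γ) ^ (dγ / 2) * √(F₁ C dC dγ K₁ K₂ / Real.logb 2 m)) := by
    have h2 : (γ * τ) ^ (1 - dγ / 2) = γ * τ * ((1 / γ) ^ (dγ / 2) * τ ^ (-(dγ / 2))) := by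
      rw [sub_eq_add_neg, Real.rpow_add (by positivity), Real.rpow_one,
        Real.mul_rpow hγ.le hτ0.le, Real.rpow_neg hγ.le, one_div, Real.inv_rpow hγ.le]
    have h3 : τ ^ (-(dγ / 2)) = √((m : ℝ) / Real.logb 2 m) := by
      rw [hτ, ← Real.rpow_mul hu0.le, Real.sqrt_eq_rpow, ← inv_div (Real.logb 2 m), ← hu, one_div,
        Real.inv_rpow hu0.le, ← Real.rpow_neg hu0.le]
      congr 1
      field_simp
    have h4 : √(F₁ C dC dγ K₁ K₂ / m) * √((m : ℝ) / Real.logb 2 m) =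
        √(F₁ C dC dγ K₁ K₂ / Real.logb 2 m) := by
      rw [← Real.sqrt_mul (by positivity)]
      congr 1
      field_simp
    rw [h2, h3, ← h4]
    ring
  calc _ ≤ γ * τ + 5 * √(F₁ C dC dγ K₁ K₂ / m) * ((1 + y) * (γ * τ) ^ (1 - dγ / 2) * 2 *
        Real.log (((C : ℝ) - 1) * (6 * (1 / τ)) ^ 5)) := by gcongr
    _ = γ * τ + 10 * (1 + y) * (√(F₁ C dC dγ K₁ K₂ / m) * (γ * τ) ^ (1 - dγ / 2)) *
        Real.log (((C : ℝ) - 1) * (6 * (1 / τ)) ^ 5) := by ring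
    _ = _ := by
        rw [hpow]
        ring

end Scales

end MarginClassifier

theorem mainTheorem1 {X : Type*} [MeasurableSpace X] (C : ℕ) (hC : 3 ≤ C)
    (P : Measure (X × Fin C)) [IsProbabilityMeasure P]
    (G : Set (X → Fin C → ℝ)) (M dC dγ K₁ K₂ : ℝ) (hM : 1 ≤ M)
    (hdC : 0 < dC ∧ dC ≤ 2) (hdγ : 0 < dγ) (hK₁ : 0 < K₁) (hK₂ : 0 < K₂)
    (hG : MarginClassifier.HasPolynomialDimensions G M dC dγ K₁ K₂)
    (γ : ℝ) (hγ : 0 < γ ∧ γ ≤ 1) (m : ℕ) (hm : 1 ≤ m) :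
    (dγ < 2 →
      MarginClassifier.rademacher P m (MarginClassifier.squashedMarginClass G γ) ≤
        10 * (1 + (2 : ℝ) ^ (2 / (2 - dγ))) *
          √(MarginClassifier.F₁ C dC dγ K₁ K₂ / m) * MarginClassifier.F₂ C dγ *
          γ ^ (1 - dγ / 2)) ∧
    (dγ = 2 → 2 ≤ m →
      MarginClassifier.rademacher P m (MarginClassifier.squashedMarginClass G γ) ≤
        γ * (Real.logb 2 m / √(m : ℝ)) +
          15 * √(MarginClassifier.F₁ C dC dγ K₁ K₂ / m) *
            (⌈Real.logb 2 (√(m : ℝ) / Real.logb 2 m)⌉ : ℝ) *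
            Real.log (((C : ℝ) - 1) * (6 * (√(m : ℝ) / Real.logb 2 m)) ^ 5)) ∧
    (2 < dγ → 2 ≤ m →
      MarginClassifier.rademacher P m (MarginClassifier.squashedMarginClass G γ) ≤
        γ * (Real.logb 2 m / m) ^ (1 / dγ) *
          (1 + 10 * (1 + (2 : ℝ) ^ (2 / (dγ - 2))) * (1 / γ) ^ (dγ / 2) *
            √(MarginClassifier.F₁ C dC dγ K₁ K₂ / Real.logb 2 m) *
            Real.log (((C : ℝ) - 1) * (6 * ((m : ℝ) / Real.logb 2 m) ^ (1 / dγ)) ^ 5))) := by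
  have hF := MarginClassifier.F₁_pos (C := C) (dC := dC) (dγ := dγ) (by omega) hK₁ hK₂
  refine ⟨fun hd => ?_, fun hd hm2 => ?_, fun hd hm2 => ?_⟩
  · have hF₂ := MarginClassifier.F₂_pos hC hd
    have := hγ.1
    exact MarginClassifier.outerExpectation_le_of_le (by positivity) fun t =>
      MarginClassifier.empiricalRademacher_le_of_lt_two hC hM hdγ hK₁ hK₂ hG hγ.1 hγ.2 hm hd t
  · have h := MarginClassifier.empiricalRademacher_le_of_eq_two hC hM hdγ hK₁ hK₂ hG hγ.1 hγ.2
      hm2 hd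
    exact MarginClassifier.outerExpectation_le_of_le
      (h fun _ => (Classical.choice (nonempty_of_isProbabilityMeasure P))).2 fun t => (h t).1
  · have h := MarginClassifier.empiricalRademacher_le_of_two_lt hC hM hK₁ hK₂ hG hγ.1 hγ.2
      hm2 hd
    exact MarginClassifier.outerExpectation_le_of_le
      (h fun _ => (Classical.choice (nonempty_of_isProbabilityMeasure P))).2 fun t => (h t).1
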